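/- Circles in the Euclidean plane are oriented: a circle of radius $r$ has signed curvature $1/r$ if its interior is taken to be the bounded side, and $-1/r$ if its interior is taken to be the unbounded side. A line together with a choice of one of its two sides as its interior counts as a circle of curvature $0$. Two circles are called tangent if they are distinct as curves, touch at exactly one point (two parallel lines touch at infinity) and have disjoint interiors. Given four mutually tangent circles, the Apollonian packing $P$ that they generate is the set of all circles obtained from them by repeatedly passing from four mutually tangent circles to four mutually tangent circles that share three circles with the former (that is, by inscribing the other circle tangent to these three). $P$ is an integer Apollonian packing if it is generated by four mutually tangent circles whose curvatures are integers. Let $\kappa(P,X)$ denote the number of distinct integers less than $X$ that occur as curvatures of circles in $P$. **Proposition 2.1.** For every integer Apollonian packing $P$ there is a constant $c>0$, depending only on $P$, such that $$\kappa(P,X)\;\ge\; c\,\frac{X}{\sqrt{\log X}}\qquad\text{for all real } X\ge 2 .$$ -/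

import Mathlib

/-- An oriented generalized circle in the Euclidean plane `ℂ`, that is, a circle or a line together
with the choice of one side, called its interior.
* `circle z b _` is the circle with centre `z` and signed curvature `b ≠ 0`, so of radius `1 / |b|`;
  its interior is the bounded side when `b > 0` and the unbounded side when `b < 0`.
* `line n p _` is the line `⟪n, w⟫ = p` with unit normal `n`; its interior is the half-plane
  `⟪n, w⟫ > p`. -/
inductive OrientedCircle : Type
  | circle (z : ℂ) (b : ℝ) (hb : b ≠ 0) : OrientedCircle
  | line (n : ℂ) (p : ℝ) (hn : ‖n‖ = 1) : OrientedCircle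

namespace OrientedCircle

/-- The signed curvature (a line has curvature `0`). -/
def curvature : OrientedCircle → ℝ
  | circle _ b _ => b
  | line _ _ _ => 0

/-- Two oriented generalized circles are tangent: they are distinct as curves, they touch at exactly
one point (the point at infinity in the case of two parallel lines), and their interiors are
disjoint.

For two circles with `b, c > 0` the condition says that the distance between the centres is
the sum of the radii. For `b < 0 < c` it says that the circle of curvature `c` lies inside the other
one, its radius is smaller (`0 < b + c`), and the distance between the centres is the difference
of the radii. Two unbounded sides always overlap, and `b, c < 0` is excluded by `0 < b + c`. -/
def Tangent : OrientedCircle → OrientedCircle → Prop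
  | circle z b _, circle w c _ => 0 < b + c ∧ dist z w = |b⁻¹ + c⁻¹|
  | circle z b _, line n p _ => 0 < b ∧ inner ℝ n z + b⁻¹ = p
  | line n p _, circle z b _ => 0 < b ∧ inner ℝ n z + b⁻¹ = p
  | line n p _, line m q _ => m = -n ∧ 0 < p + q

end OrientedCircle

/-- A Descartes configuration: four mutually tangent circles (lines being allowed). -/
def IsDescartes (D : Fin 4 → OrientedCircle) : Prop :=
  Pairwise fun i j => (D i).Tangent (D j)

/-- The Descartes configurations obtained from `D` by repeatedly keeping three of the four circles
and inscribing a circle `C` tangent to these three in place of the fourth. (Exactly two circles are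
tangent to the three; one of them is the fourth circle itself.) -/
inductive Reachable (D : Fin 4 → OrientedCircle) : (Fin 4 → OrientedCircle) → Prop
  | base : Reachable D D
  | step (q : Fin 4 → OrientedCircle) (i : Fin 4) (C : OrientedCircle) (hq : Reachable D q)
      (hC : ∀ j, j ≠ i → C.Tangent (q j)) : Reachable D (Function.update q i C)

/-- The Apollonian packing generated by `D`: all circles of the configurations reachable from `D`. -/
def apollonianPacking (D : Fin 4 → OrientedCircle) : Set OrientedCircle :=
  {C | ∃ q, Reachable D q ∧ ∃ i, q i = C}

/-- `P` is an integer Apollonian packing: it is generated by four mutually tangent circles whose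
curvatures are integers. -/
def IsIntegerPacking (P : Set OrientedCircle) : Prop :=
  ∃ D : Fin 4 → OrientedCircle, IsDescartes D ∧ (∀ i, ∃ n : ℤ, (D i).curvature = n) ∧
    P = apollonianPacking D

/-- `κ(P, X)`: the number of distinct integers less than `X` that occur as curvatures in `P`. -/
noncomputable def kappa (P : Set OrientedCircle) (X : ℝ) : ℕ :=
  {n : ℤ | (n : ℝ) < X ∧ ∃ C ∈ P, C.curvature = n}.ncard

/-!
The circles of the packing that are tangent to a fixed one of curvature `a ≠ 0` have the curvatures
`f(x, y) - a`, where `f` is a positive definite integral binary quadratic form of determinant `a²`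
and `(x, y)` runs through the primitive vectors; changes of basis of `ℤ²` are exchanges of circles
(`Realizes.exists_curvature`). So it suffices to bound below the number of values of such a form,
in the manner of Landau and Bernays.

*Geometry.* In Minkowski coordinates tangency says that two vectors have product `-1` and a sum in
the forward light cone. This gives Descartes' theorem and the existence of the exchanged circle. The
set counted by `kappa` must be shown to be finite: a configuration of minimal total curvature is
reached by descent, and from it exchanges only need to go up (`exists_le_curvature`).

*Reduction to split numbers.* Call `n` split (with respect to an even `Q`) if its prime factors are
congruent to `1` modulo `4` and prime to `Q`. Such an `n` is the norm of a primitive Gaussian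
integer `z`. The product of `z` and the conjugate of a representative `z₀` of its residue class has
the form `u + a v i`, and `f` takes the value `A (u² + a² v²)`, where `A = f(1, 0)`, at a primitive
vector. As there are finitely many classes, the number of curvatures is bounded below by a constant
times the number of split numbers (`exists_card_splitNumbers_le_kappa`).

*Counting split numbers.* Let `L(N)` be the sum of `1 / n` over the split numbers `n ≤ N`. A split
number has at most `4 τ(n)` primitive representations as a sum of two squares, and its divisors are
split; hence the sum of the reciprocals of the norms of suitable lattice points, which is of order
`log N`, is at most a constant times `L(N)²` (`log_le_sq_sum_splitNumbers`). On the other hand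
Mertens' theorem and the boundedness of `∑ χ₄(d) Λ(d) / d` give a Chebyshev lower bound for the
primes congruent to `1` modulo `4` (`exists_le_sum_log_splitPrime`), and the factorizations `n = p m`
show that `N L(N)` is at most a constant times `log N` times the number of split numbers up to `N`.
Together these give `N / √(log N)` (`exists_le_card_splitNumbers`).
-/

/-! ### Minkowski coordinates of circles -/

namespace OrientedCircle

/-- Minkowski coordinates `(b, b', Re w, Im w)` of an oriented generalized circle: the curvature,
the curvature of the image under inversion in the unit circle, and the curvature times the centre
(for a line: its unit normal). -/
noncomputable def lorentz : OrientedCircle → Fin 4 → ℝ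
  | circle z b _ => ![b, b * (z.re ^ 2 + z.im ^ 2) - b⁻¹, b * z.re, b * z.im]
  | line n p _ => ![0, 2 * p, n.re, n.im]

/-- The bilinear form of signature `(3, 1)` on Minkowski coordinates. -/
noncomputable def lorentzForm (v w : Fin 4 → ℝ) : ℝ :=
  v 2 * w 2 + v 3 * w 3 - (v 0 * w 1 + v 1 * w 0) / 2

lemma lorentz_zero (C : OrientedCircle) : C.lorentz 0 = C.curvature := by
  cases C <;> rfl

lemma sq_add_sq_eq_one {n : ℂ} (hn : ‖n‖ = 1) : n.re ^ 2 + n.im ^ 2 = 1 := by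
  have h := Complex.sq_norm n
  rw [hn, Complex.normSq_apply] at h
  linarith

lemma lorentzForm_self (C : OrientedCircle) : lorentzForm C.lorentz C.lorentz = 1 := by
  cases C with
  | circle z b hb =>
    simp only [lorentzForm, lorentz, Matrix.cons_val]
    field_simp
    ring
  | line n p hn =>
    simp only [lorentzForm, lorentz, Matrix.cons_val]
    linarith [sq_add_sq_eq_one hn]

lemma lorentzForm_comm (v w : Fin 4 → ℝ) : lorentzForm v w = lorentzForm w v := by
  unfold lorentzForm; ring

lemma exists_lorentz_eq {v : Fin 4 → ℝ} (hv : lorentzForm v v = 1) :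
    ∃ C : OrientedCircle, C.lorentz = v := by
  unfold lorentzForm at hv
  by_cases hb : v 0 = 0
  · refine ⟨line ⟨v 2, v 3⟩ (v 1 / 2) ?_, ?_⟩
    · rw [← sq_eq_sq₀ (norm_nonneg _) zero_le_one, Complex.sq_norm, Complex.normSq_apply]
      simp only [hb] at hv
      linarith
    · ext i
      fin_cases i <;> simp [lorentz, hb]
      ring
  · refine ⟨circle ⟨v 2 / v 0, v 3 / v 0⟩ (v 0) hb, ?_⟩
    ext i
    fin_cases i <;> simp [lorentz] <;> field_simp
    linarith

lemma dist_eq_abs_iff (z w : ℂ) (r : ℝ) :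
    dist z w = |r| ↔ (z.re - w.re) ^ 2 + (z.im - w.im) ^ 2 = r ^ 2 := by
  rw [← sq_eq_sq₀ dist_nonneg (abs_nonneg _), sq_abs, Complex.dist_eq, Complex.sq_norm,
    Complex.normSq_apply]
  simp only [Complex.sub_re, Complex.sub_im, sq]

/-- Tangency in Minkowski coordinates: the sum of the two vectors is a nonzero null vector of the
forward light cone. -/
lemma tangent_iff (C C' : OrientedCircle) : C.Tangent C' ↔ lorentzForm C.lorentz C'.lorentz = -1 ∧
    0 < C.lorentz 0 + C.lorentz 1 + C'.lorentz 0 + C'.lorentz 1 := by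
  have key : ∀ (n : ℂ) (p : ℝ) (_ : ‖n‖ = 1) (z : ℂ) (b : ℝ) (_ : b ≠ 0),
      (0 < b ∧ inner ℝ n z + b⁻¹ = p) ↔
      (n.re * (b * z.re) + n.im * (b * z.im) - 2 * p * b / 2 = -1 ∧
        0 < 2 * p + b + (b * (z.re ^ 2 + z.im ^ 2) - b⁻¹)) := by
    intro n p hn z b hb
    have h1 := sq_add_sq_eq_one hn
    have hi : inner ℝ n z = n.re * z.re + n.im * z.im := by
      rw [Complex.inner]
      simp [Complex.mul_re]
      ring
    have e : inner ℝ n z + b⁻¹ = p ↔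
        n.re * (b * z.re) + n.im * (b * z.im) - 2 * p * b / 2 = -1 := by
      rw [hi]
      field_simp
      constructor <;> intro h <;> linarith
    rw [e, and_comm]
    refine and_congr_right fun h => ?_
    have hnull : b * (2 * p + (b * (z.re ^ 2 + z.im ^ 2) - b⁻¹)) =
        (n.re + b * z.re) ^ 2 + (n.im + b * z.im) ^ 2 := by
      have : b * b⁻¹ = 1 := mul_inv_cancel₀ hb
      linear_combination -2 * h - h1 - this
    constructor
    · intro hb0
      have : 0 ≤ 2 * p + (b * (z.re ^ 2 + z.im ^ 2) - b⁻¹) := by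
        by_contra! hc
        nlinarith [sq_nonneg (n.re + b * z.re), sq_nonneg (n.im + b * z.im)]
      linarith
    · intro hs
      by_contra! hc
      have hb0 : b < 0 := lt_of_le_of_ne hc hb
      nlinarith [sq_nonneg (n.re + b * z.re), sq_nonneg (n.im + b * z.im)]
  cases C with
  | circle z b hb =>
    cases C' with
    | circle w c hc =>
      simp only [Tangent, dist_eq_abs_iff, lorentzForm, lorentz, Matrix.cons_val]
      set Z := z.re ^ 2 + z.im ^ 2 with hZ
      set W := w.re ^ 2 + w.im ^ 2 with hW
      have e : (z.re - w.re) ^ 2 + (z.im - w.im) ^ 2 = (b⁻¹ + c⁻¹) ^ 2 ↔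
          b * z.re * (c * w.re) + b * z.im * (c * w.im) -
            (b * (c * W - c⁻¹) + (b * Z - b⁻¹) * c) / 2 = -1 := by
        rw [hZ, hW]
        field_simp
        constructor <;> intro h <;> linarith
      rw [e, and_comm]
      refine and_congr_right fun h => ?_
      have h1 : b * b⁻¹ = 1 := mul_inv_cancel₀ hb
      have h2 : c * c⁻¹ = 1 := mul_inv_cancel₀ hc
      have hnull : (b + c) * ((b * Z - b⁻¹) + (c * W - c⁻¹)) =
          (b * z.re + c * w.re) ^ 2 + (b * z.im + c * w.im) ^ 2 := by
        linear_combination -h1 - h2 - 2 * h + b ^ 2 * hZ + c ^ 2 * hW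
      constructor
      · intro hp
        have : 0 ≤ (b * Z - b⁻¹) + (c * W - c⁻¹) := by
          by_contra! hc
          nlinarith [sq_nonneg (b * z.re + c * w.re), sq_nonneg (b * z.im + c * w.im)]
        linarith
      · intro hs
        by_contra! hle
        rcases hle.lt_or_eq with hlt | heq
        · nlinarith [sq_nonneg (b * z.re + c * w.re), sq_nonneg (b * z.im + c * w.im)]
        · -- opposite curvatures force equal centres, and then the two vectors are opposite
          have hcb : c = -b := by linarith
          rw [heq, zero_mul] at hnull
          have e1 : b * z.re + c * w.re = 0 := by
            nlinarith [sq_nonneg (b * z.re + c * w.re), sq_nonneg (b * z.im + c * w.im)]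
          have e2 : b * z.im + c * w.im = 0 := by
            nlinarith [sq_nonneg (b * z.re + c * w.re), sq_nonneg (b * z.im + c * w.im)]
          have e3 : z.re = w.re := mul_left_cancel₀ hb (by rw [hcb] at e1; linarith)
          have e4 : z.im = w.im := mul_left_cancel₀ hb (by rw [hcb] at e2; linarith)
          have e5 : Z = W := by rw [hZ, hW, e3, e4]
          rw [hcb, e5, inv_neg] at hs
          linarith
    | line n p hn =>
      simp only [Tangent, key n p hn z b hb, lorentzForm, lorentz, Matrix.cons_val]
      constructor <;> rintro ⟨h1, h2⟩ <;> constructor <;> linarith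
  | line n p hn =>
    cases C' with
    | circle z b hb =>
      simp only [Tangent, key n p hn z b hb, lorentzForm, lorentz, Matrix.cons_val]
      constructor <;> rintro ⟨h1, h2⟩ <;> constructor <;> linarith
    | line m q hm =>
      simp only [Tangent, lorentzForm, lorentz, Matrix.cons_val]
      have h1 := sq_add_sq_eq_one hn
      have h2 := sq_add_sq_eq_one hm
      refine and_congr ?_ ?_
      · constructor
        · rintro rfl
          simp only [Complex.neg_re, Complex.neg_im]
          linarith
        · intro h
          have e : (m.re + n.re) ^ 2 + (m.im + n.im) ^ 2 = 0 := by linarith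
          apply Complex.ext
          · simp only [Complex.neg_re]
            nlinarith [sq_nonneg (m.re + n.re), sq_nonneg (m.im + n.im)]
          · simp only [Complex.neg_im]
            nlinarith [sq_nonneg (m.re + n.re), sq_nonneg (m.im + n.im)]
      · constructor <;> intro h <;> linarith

lemma Tangent.symm {C C' : OrientedCircle} (h : C.Tangent C') : C'.Tangent C := by
  rw [tangent_iff] at h ⊢
  rw [lorentzForm_comm]
  exact ⟨h.1, by linarith [h.2]⟩

/-- Two tangent circles have nonnegative total curvature. -/
lemma Tangent.curvature_add_nonneg {C C' : OrientedCircle} (h : C.Tangent C') :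
    0 ≤ C.curvature + C'.curvature := by
  cases C <;> cases C' <;> simp only [Tangent, curvature] at h ⊢ <;> linarith [h.1]

end OrientedCircle

open OrientedCircle

/-! ### Descartes configurations -/

/-- The Gram matrix of a Descartes configuration determines all bilinear relations between the
Minkowski coordinates: the matrix identity `Vᵀ G⁻¹ V = H⁻¹`, where `V` has the four vectors as rows,
`H` is the matrix of the form and `G = 2 - J` the Gram matrix, is the generalized Descartes
theorem. -/
lemma IsDescartes.transpose_mul {D : Fin 4 → OrientedCircle} (hD : IsDescartes D) :
    (Matrix.of fun i j => (D i).lorentz j).transpose *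
      ((1 / 4 : ℝ) • !![1, -1, -1, -1; -1, 1, -1, -1; -1, -1, 1, -1; -1, -1, -1, 1]) *
      (Matrix.of fun i j => (D i).lorentz j) =
      !![0, -2, 0, 0; -2, 0, 0, 0; 0, 0, 1, 0; 0, 0, 0, 1] := by
  set V : Matrix (Fin 4) (Fin 4) ℝ := Matrix.of fun i j => (D i).lorentz j with hV
  set G' : Matrix (Fin 4) (Fin 4) ℝ :=
    (1 / 4 : ℝ) • !![1, -1, -1, -1; -1, 1, -1, -1; -1, -1, 1, -1; -1, -1, -1, 1]
  set H : Matrix (Fin 4) (Fin 4) ℝ :=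
    !![0, -1/2, 0, 0; -1/2, 0, 0, 0; 0, 0, 1, 0; 0, 0, 0, 1] with hH
  set H' : Matrix (Fin 4) (Fin 4) ℝ :=
    !![0, -2, 0, 0; -2, 0, 0, 0; 0, 0, 1, 0; 0, 0, 0, 1] with hH'
  have hHH : H' * H = 1 := by
    rw [hH, hH']
    ext i j
    fin_cases i <;> fin_cases j <;> simp [Matrix.mul_apply, Fin.sum_univ_four] <;>
      norm_num
  have hgram : V * H * V.transpose =
      !![1, -1, -1, -1; -1, 1, -1, -1; -1, -1, 1, -1; -1, -1, -1, 1] := by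
    have h1 : ∀ i j, (V * H * V.transpose) i j = lorentzForm (D i).lorentz (D j).lorentz := by
      intro i j
      simp [Matrix.mul_apply, Fin.sum_univ_four, hH, hV, lorentzForm]
      ring
    have h2 : ∀ i j, i ≠ j → lorentzForm (D i).lorentz (D j).lorentz = -1 :=
      fun i j hij => ((tangent_iff _ _).1 (hD hij)).1
    ext i j
    rw [h1]
    fin_cases i <;> fin_cases j <;> first | exact lorentzForm_self _ | exact h2 _ _ (by decide)
  have hGG : (V * H * V.transpose) * G' = 1 := by
    rw [hgram]
    ext i j
    fin_cases i <;> fin_cases j <;> simp [G', Matrix.mul_apply, Fin.sum_univ_four] <;> norm_num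
  have h3 : H * V.transpose * G' * V = 1 := by
    rw [Matrix.mul_assoc, Matrix.mul_assoc] at hGG
    rw [Matrix.mul_assoc H, Matrix.mul_assoc H, ← Matrix.mul_assoc]
    have := mul_eq_one_comm.1 hGG
    simpa [Matrix.mul_assoc] using this
  calc V.transpose * G' * V = (H' * H) * (V.transpose * G' * V) := by rw [hHH, one_mul]
    _ = H' * (H * V.transpose * G' * V) := by simp only [Matrix.mul_assoc]
    _ = H' := by rw [h3, mul_one]

/-- **Descartes' circle theorem.** -/
lemma IsDescartes.sq_sum {D : Fin 4 → OrientedCircle} (hD : IsDescartes D) :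
    (∑ i, (D i).curvature) ^ 2 = 2 * ∑ i, (D i).curvature ^ 2 := by
  have h := congrFun (congrFun hD.transpose_mul 0) 0
  simp [Matrix.mul_apply, Fin.sum_univ_four] at h
  simp only [Fin.sum_univ_four, ← lorentz_zero]
  linarith

/-- Four mutually tangent circles are not all lines. -/
lemma IsDescartes.exists_curvature_ne_zero {D : Fin 4 → OrientedCircle} (hD : IsDescartes D) :
    ∃ i, (D i).curvature ≠ 0 := by
  by_contra! hc
  have h := congrFun (congrFun hD.transpose_mul 0) 1
  simp [Matrix.mul_apply, lorentz_zero, hc] at h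

/-- A null vector with negative product with a forward null vector is itself forward. -/
lemma forward_of_null {p q : Fin 4 → ℝ} (hp : lorentzForm p p = 0) (hq : lorentzForm q q = 0)
    (hp0 : 0 < p 0 + p 1) (hpq : lorentzForm q p < 0) : 0 < q 0 + q 1 := by
  unfold lorentzForm at *
  by_contra! hc
  have hp1 : p 0 * p 1 = p 2 ^ 2 + p 3 ^ 2 := by linarith
  have hq1 : q 0 * q 1 = q 2 ^ 2 + q 3 ^ 2 := by linarith
  have a0 : 0 ≤ p 0 := by nlinarith [sq_nonneg (p 2), sq_nonneg (p 3), sq_nonneg (p 0)]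
  have a1 : 0 ≤ p 1 := by nlinarith [sq_nonneg (p 2), sq_nonneg (p 3), sq_nonneg (p 1)]
  have b0 : q 0 ≤ 0 := by nlinarith [sq_nonneg (q 2), sq_nonneg (q 3), sq_nonneg (q 0)]
  have b1 : q 1 ≤ 0 := by nlinarith [sq_nonneg (q 2), sq_nonneg (q 3), sq_nonneg (q 1)]
  set s := q 2 * p 2 + q 3 * p 3 with hs
  set t := (q 0 * p 1 + q 1 * p 0) / 2 with ht
  have t0 : t ≤ 0 := by nlinarith
  have h1 : s ^ 2 ≤ (p 0 * p 1) * (q 0 * q 1) := by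
    rw [hp1, hq1]
    nlinarith [sq_nonneg (q 2 * p 3 - q 3 * p 2)]
  have h2 : (p 0 * p 1) * (q 0 * q 1) ≤ t ^ 2 := by
    nlinarith [sq_nonneg (q 0 * p 1 - q 1 * p 0)]
  nlinarith

/-- In a Descartes configuration each circle can be exchanged for the second circle tangent to the
other three, whose Minkowski vector is the reflection `2 ∑ vⱼ - 3 vᵢ` of `vᵢ`. -/
lemma IsDescartes.exists_exchange {D : Fin 4 → OrientedCircle} (hD : IsDescartes D) (i : Fin 4) :
    ∃ C : OrientedCircle, (∀ j, j ≠ i → C.Tangent (D j)) ∧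
      C.curvature = 2 * ∑ j, (D j).curvature - 3 * (D i).curvature := by
  set V : Fin 4 → Fin 4 → ℝ := fun j => (D j).lorentz with hV
  set v : Fin 4 → ℝ := fun k => 2 * ∑ j, V j k - 3 * V i k with hv
  have hself : ∀ j, lorentzForm (V j) (V j) = 1 := fun j => lorentzForm_self _
  have hne : ∀ j k, j ≠ k → lorentzForm (V j) (V k) = -1 :=
    fun j k h => ((tangent_iff _ _).1 (hD h)).1
  have hlin : ∀ w, lorentzForm v w = 2 * ∑ j, lorentzForm (V j) w - 3 * lorentzForm (V i) w := by
    intro w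
    simp only [hv, lorentzForm, Fin.sum_univ_four]
    ring
  have hsum : ∀ k, ∑ j, lorentzForm (V j) (V k) = -2 := by
    intro k
    rw [← Finset.add_sum_erase _ _ (Finset.mem_univ k), hself,
      Finset.sum_congr rfl fun j hj => hne j k (Finset.ne_of_mem_erase hj)]
    simp
    norm_num
  have hvi : lorentzForm v (V i) = -7 := by rw [hlin, hsum, hself]; norm_num
  have hvj : ∀ j, j ≠ i → lorentzForm v (V j) = -1 := by
    intro j hj
    rw [hlin, hsum, hne i j hj.symm]; norm_num
  have hvv : lorentzForm v v = 1 := by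
    have : ∑ j, lorentzForm (V j) v = -10 := by
      simp only [lorentzForm_comm _ v]
      rw [← Finset.add_sum_erase _ _ (Finset.mem_univ i), hvi,
        Finset.sum_congr rfl fun j hj => hvj j (Finset.ne_of_mem_erase hj)]
      simp
      norm_num
    rw [hlin, this, lorentzForm_comm, hvi]; norm_num
  have hadd : ∀ a b c d : Fin 4 → ℝ, lorentzForm (a + b) (c + d) =
      lorentzForm a c + lorentzForm a d + lorentzForm b c + lorentzForm b d := by
    intro a b c d
    simp only [lorentzForm, Pi.add_apply]
    ring
  obtain ⟨C, hC⟩ := exists_lorentz_eq hvv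
  refine ⟨C, fun j hj => ?_, ?_⟩
  · rw [tangent_iff, hC]
    refine ⟨hvj j hj, ?_⟩
    have hpos := ((tangent_iff _ _).1 (hD (Ne.symm hj))).2
    have := forward_of_null (p := V i + V j) (q := v + V j)
      (by rw [hadd, hself, hself, hne i j hj.symm, hne j i hj]; norm_num)
      (by rw [hadd, hvv, hself, lorentzForm_comm (V j), hvj j hj]; norm_num)
      (by simp only [Pi.add_apply, hV]; linarith)
      (by rw [hadd, hvi, hvj j hj, hne j i hj, hself]; norm_num)
    simp only [Pi.add_apply] at this
    show 0 < v 0 + v 1 + V j 0 + V j 1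
    linarith
  · simp only [← lorentz_zero, hC, hv, hV]

lemma IsDescartes.update {D : Fin 4 → OrientedCircle} (hD : IsDescartes D) {i : Fin 4}
    {C : OrientedCircle} (hC : ∀ j, j ≠ i → C.Tangent (D j)) :
    IsDescartes (Function.update D i C) := by
  intro j k hjk
  by_cases hj : j = i
  · subst hj
    simpa [Function.update_of_ne hjk.symm] using hC k hjk.symm
  · by_cases hk : k = i
    · subst hk
      simpa [Function.update_of_ne hj] using (hC j hj).symm
    · simpa [Function.update_of_ne hj, Function.update_of_ne hk] using hD hjk

/-! ### Curvature quadruples under exchanges -/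

/-- The curvatures of a quadruple of circles. -/
def curvatures (q : Fin 4 → OrientedCircle) : Fin 4 → ℝ := fun i => (q i).curvature

/-- The effect on curvatures of exchanging the `i`-th circle. -/
noncomputable def exchange (i : Fin 4) (x : Fin 4 → ℝ) : Fin 4 → ℝ :=
  Function.update x i (2 * ∑ j, x j - 3 * x i)

lemma sum_update_eq (x : Fin 4 → ℝ) (i : Fin 4) (t : ℝ) :
    ∑ j, Function.update x i t j = ∑ j, x j - x i + t := by
  rw [Finset.sum_update_of_mem (Finset.mem_univ i), ← Finset.add_sum_erase _ x (Finset.mem_univ i),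
    Finset.sdiff_singleton_eq_erase]
  ring

lemma sum_exchange (i : Fin 4) (x : Fin 4 → ℝ) : ∑ j, exchange i x j = 3 * ∑ j, x j - 4 * x i := by
  rw [exchange, sum_update_eq]
  ring

lemma exchange_self (i : Fin 4) (x : Fin 4 → ℝ) : exchange i x i = 2 * ∑ j, x j - 3 * x i :=
  Function.update_self _ _ _

lemma exchange_of_ne {i j : Fin 4} (h : j ≠ i) (x : Fin 4 → ℝ) : exchange i x j = x j :=
  Function.update_of_ne h _ _

lemma exchange_exchange (i : Fin 4) (x : Fin 4 → ℝ) : exchange i (exchange i x) = x := by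
  ext j
  by_cases h : j = i
  · subst h
    rw [exchange_self, sum_exchange, exchange_self]
    ring
  · rw [exchange_of_ne h, exchange_of_ne h]

lemma Reachable.isDescartes {D q : Fin 4 → OrientedCircle} (hD : IsDescartes D)
    (h : Reachable D q) : IsDescartes q := by
  induction h with
  | base => exact hD
  | step q i C _ hC ih => exact ih.update hC

/-- A circle tangent to three circles of a Descartes configuration has the curvature of the fourth
one or of its exchange: both are roots of Descartes' quadratic equation. -/
lemma IsDescartes.curvatures_update {q : Fin 4 → OrientedCircle} (hq : IsDescartes q) {i : Fin 4}
    {C : OrientedCircle} (hC : ∀ j, j ≠ i → C.Tangent (q j)) :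
    curvatures (Function.update q i C) = curvatures q ∨
      curvatures (Function.update q i C) = exchange i (curvatures q) := by
  have e : curvatures (Function.update q i C) = Function.update (curvatures q) i C.curvature := by
    ext j
    by_cases h : j = i
    · subst h; simp [curvatures]
    · simp [curvatures, Function.update_of_ne h]
  have h1 : (∑ j, curvatures q j) ^ 2 = 2 * ∑ j, curvatures q j ^ 2 := hq.sq_sum
  have h2 : (∑ j, curvatures (Function.update q i C) j) ^ 2 =
    2 * ∑ j, curvatures (Function.update q i C) j ^ 2 := (hq.update hC).sq_sum
  rw [e] at h2 ⊢
  rw [sum_update_eq] at h2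
  have h3 : ∑ j, Function.update (curvatures q) i C.curvature j ^ 2 =
      ∑ j, curvatures q j ^ 2 - curvatures q i ^ 2 + C.curvature ^ 2 := by
    rw [← Finset.add_sum_erase _ _ (Finset.mem_univ i),
      ← Finset.add_sum_erase _ (fun j => curvatures q j ^ 2) (Finset.mem_univ i),
      Finset.sum_congr rfl fun j hj => by rw [Function.update_of_ne (Finset.ne_of_mem_erase hj)],
      Function.update_self]
    ring
  rw [h3] at h2
  have h4 : (C.curvature - curvatures q i) *
      (C.curvature - (2 * ∑ j, curvatures q j - 3 * curvatures q i)) = 0 := by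
    linear_combination h1 - h2
  rcases mul_eq_zero.1 h4 with h | h
  · left
    rw [sub_eq_zero.1 h, Function.update_eq_self]
  · right
    rw [sub_eq_zero.1 h, exchange]

lemma Reachable.exists_exchange {D q : Fin 4 → OrientedCircle} (hD : IsDescartes D)
    (h : Reachable D q) (i : Fin 4) :
    ∃ q', Reachable D q' ∧ (∀ j, j ≠ i → q' j = q j) ∧
      curvatures q' = exchange i (curvatures q) := by
  obtain ⟨C, hC, hc⟩ := (h.isDescartes hD).exists_exchange i
  refine ⟨_, h.step q i C hC, fun j hj => Function.update_of_ne hj _ _, ?_⟩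
  ext j
  by_cases hj : j = i
  · subst hj
    simp [curvatures, exchange, hc]
  · simp [curvatures, exchange, Function.update_of_ne hj]

lemma Reachable.curvatures_int {D q : Fin 4 → OrientedCircle} (hD : IsDescartes D)
    (hint : ∀ i, ∃ n : ℤ, (D i).curvature = n) (h : Reachable D q) :
    ∀ i, ∃ n : ℤ, curvatures q i = n := by
  induction h with
  | base => exact hint
  | step q i C hq hC ih =>
    rcases (hq.isDescartes hD).curvatures_update hC with e | e
    · rwa [e]
    · intro j
      rw [e]
      by_cases hj : j = i
      · subst hj
        choose n hn using ih
        refine ⟨2 * ∑ k, n k - 3 * n j, ?_⟩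
        rw [exchange_self]
        push_cast
        simp only [hn]
      · rw [exchange_of_ne hj]
        exact ih j

lemma IsDescartes.curvatures_add_nonneg {q : Fin 4 → OrientedCircle} (hq : IsDescartes q)
    {i j : Fin 4} (hij : i ≠ j) : 0 ≤ curvatures q i + curvatures q j :=
  (hq hij).curvature_add_nonneg

lemma sum_eq_add_four (x : Fin 4 → ℝ) {i j : Fin 4} (hij : i ≠ j) :
    ∃ k l, k ≠ l ∧ i ≠ k ∧ i ≠ l ∧ j ≠ k ∧ j ≠ l ∧ ∑ m, x m = x i + x j + x k + x l := by
  have h : ∀ i j : Fin 4, i ≠ j → ∃ k l, k ≠ l ∧ i ≠ k ∧ i ≠ l ∧ j ≠ k ∧ j ≠ l ∧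
      Finset.univ = {i, j, k, l} := by decide
  obtain ⟨k, l, hkl, hik, hil, hjk, hjl, hu⟩ := h i j hij
  refine ⟨k, l, hkl, hik, hil, hjk, hjl, ?_⟩
  rw [hu, Finset.sum_insert (by simp [*]), Finset.sum_insert (by simp [*]),
    Finset.sum_pair hkl]
  ring

/-- There is a root quadruple, in which no exchange decreases a curvature: the total curvatures of
the configurations are nonnegative integers, and a minimal one will do. -/
lemma exists_root {D : Fin 4 → OrientedCircle} (hD : IsDescartes D)
    (hint : ∀ i, ∃ n : ℤ, (D i).curvature = n) :
    ∃ r, Reachable D r ∧ ∀ i, curvatures r i ≤ exchange i (curvatures r) i := by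
  have hnat : ∀ q, Reachable D q → ∃ n : ℕ, ∑ i, curvatures q i = n := by
    intro q hq
    choose n hn using hq.curvatures_int hD hint
    have h0 : 0 ≤ ∑ i, n i := by
      have h1 := (hq.isDescartes hD).curvatures_add_nonneg (i := 0) (j := 1) (by decide)
      have h2 := (hq.isDescartes hD).curvatures_add_nonneg (i := 2) (j := 3) (by decide)
      simp only [hn] at h1 h2
      norm_cast at h1 h2
      rw [Fin.sum_univ_four]
      linarith
    refine ⟨(∑ i, n i).toNat, ?_⟩
    simp only [hn]
    have : (((∑ i, n i).toNat : ℤ) : ℝ) = ((∑ i, n i : ℤ) : ℝ) := by rw [Int.toNat_of_nonneg h0]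
    rw [← Int.cast_natCast (R := ℝ), this]
    push_cast
    rfl
  have hex : ∃ n : ℕ, ∃ q, Reachable D q ∧ ∑ i, curvatures q i = n := by
    obtain ⟨n, hn⟩ := hnat D .base
    exact ⟨n, D, .base, hn⟩
  classical
  obtain ⟨r, hr, hrn⟩ := Nat.find_spec hex
  refine ⟨r, hr, fun i => ?_⟩
  by_contra! hlt
  obtain ⟨q, hq, -, hqr⟩ := hr.exists_exchange hD i
  obtain ⟨m, hm⟩ := hnat q hq
  have hmin : Nat.find hex ≤ m := Nat.find_min' hex ⟨q, hq, hm⟩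
  have hmin' : ((Nat.find hex : ℕ) : ℝ) ≤ m := by exact_mod_cast hmin
  rw [← hm, ← hrn, hqr, sum_exchange] at hmin'
  rw [exchange_self] at hlt
  linarith

/-- An exchange that decreases a curvature replaces the strictly largest one. -/
lemma lt_of_exchange_lt {x : Fin 4 → ℝ} (hx : ∀ i j, i ≠ j → 0 ≤ x i + x j) {i j : Fin 4}
    (hij : i ≠ j) (h : exchange i x i < x i) : x j < x i := by
  obtain ⟨k, l, hkl, -, -, -, -, hs⟩ := sum_eq_add_four x hij
  rw [exchange_self, hs] at h
  linarith [hx k l hkl]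

/-- The quadruples obtained from `r` by exchanges none of which decreases a curvature. -/
inductive Ascending (r : Fin 4 → ℝ) : (Fin 4 → ℝ) → Prop
  | base : Ascending r r
  | step (x : Fin 4 → ℝ) (i : Fin 4) (hx : Ascending r x) (h : x i ≤ exchange i x i) :
      Ascending r (exchange i x)

lemma Ascending.le {r x : Fin 4 → ℝ} (h : Ascending r x) (i : Fin 4) : r i ≤ x i := by
  induction h with
  | base => exact le_rfl
  | step x j _ hj ih =>
    by_cases hij : i = j
    · subst hij; exact ih.trans hj
    · rw [exchange_of_ne hij]; exact ih

/-- Starting from a root quadruple, ascending exchanges produce everything: an exchange that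
decreases a curvature replaces the largest one, hence undoes the last step. -/
lemma Ascending.exchange {r x : Fin 4 → ℝ} (hr : ∀ i j, i ≠ j → 0 ≤ r i + r j)
    (hroot : ∀ i, r i ≤ exchange i r i) (h : Ascending r x) (i : Fin 4) :
    Ascending r (exchange i x) := by
  have hpair : ∀ {y}, Ascending r y → ∀ i j, i ≠ j → 0 ≤ y i + y j := fun hy i j hij =>
    (hr i j hij).trans (add_le_add (hy.le i) (hy.le j))
  by_cases hi : x i ≤ _root_.exchange i x i
  · exact h.step x i hi
  · rw [not_le] at hi
    cases h with
    | base => exact absurd (hroot i) (not_le.2 hi)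
    | step y j hy hj =>
      by_cases hij : i = j
      · subst hij
        rwa [exchange_exchange]
      · have h1 := lt_of_exchange_lt (hpair (hy.step y j hj)) hij hi
        obtain ⟨k, l, hkl, -, -, -, -, hs⟩ := sum_eq_add_four y hij
        have h2 := hpair hy k l hkl
        rw [exchange_self, exchange_of_ne hij] at h1
        rw [exchange_self] at hj
        linarith

/-- The curvatures in an integer packing are bounded below. -/
lemma exists_le_curvature {D : Fin 4 → OrientedCircle} (hD : IsDescartes D)
    (hint : ∀ i, ∃ n : ℤ, (D i).curvature = n) :
    ∃ m : ℝ, ∀ C ∈ apollonianPacking D, m ≤ C.curvature := by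
  obtain ⟨r, hr, hroot⟩ := exists_root hD hint
  have hpair : ∀ i j, i ≠ j → 0 ≤ curvatures r i + curvatures r j :=
    fun i j hij => (hr.isDescartes hD).curvatures_add_nonneg hij
  have hiff : ∀ q, Reachable D q →
      (Ascending (curvatures r) (curvatures q) ↔ Ascending (curvatures r) (curvatures D)) := by
    intro q hq
    induction hq with
    | base => rfl
    | step q i C hq hC ih =>
      rcases (hq.isDescartes hD).curvatures_update hC with e | e
      · rw [e, ih]
      · rw [e, ← ih]
        refine ⟨fun h => ?_, fun h => h.exchange hpair hroot i⟩
        simpa [exchange_exchange] using h.exchange hpair hroot i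
  have hDr := (hiff r hr).1 .base
  refine ⟨min (min (curvatures r 0) (curvatures r 1)) (min (curvatures r 2) (curvatures r 3)), ?_⟩
  rintro C ⟨q, hq, i, rfl⟩
  refine le_trans ?_ (((hiff q hq).2 hDr).le i)
  fin_cases i <;> simp

/-- An integer packing contains a circle of nonpositive curvature: in a root quadruple no curvature
exceeds half the sum, and by Descartes' theorem each one is then `0` or half the sum. -/
lemma exists_curvature_nonpos {D : Fin 4 → OrientedCircle} (hD : IsDescartes D)
    (hint : ∀ i, ∃ n : ℤ, (D i).curvature = n) :
    ∃ C ∈ apollonianPacking D, C.curvature ≤ 0 := by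
  obtain ⟨r, hr, hroot⟩ := exists_root hD hint
  by_contra! hc
  have hpos : ∀ i, 0 < curvatures r i := fun i => hc _ ⟨r, hr, i, rfl⟩
  have hsq : (∑ i, curvatures r i) ^ 2 = 2 * ∑ i, curvatures r i ^ 2 :=
    (hr.isDescartes hD).sq_sum
  simp only [exchange_self] at hroot
  set x := curvatures r
  set S := ∑ i, x i with hS
  have h0 : ∀ i, 0 ≤ x i * (S / 2 - x i) :=
    fun i => mul_nonneg (hpos i).le (by linarith [hroot i])
  have hsum : ∑ i, x i * (S / 2 - x i) = 0 := by
    have : ∑ i, x i * (S / 2 - x i) = S / 2 * S - ∑ i, x i ^ 2 := by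
      rw [hS, Finset.mul_sum, ← Finset.sum_sub_distrib]
      exact Finset.sum_congr rfl fun i _ => by ring
    rw [this]
    linarith
  have h1 : ∀ i, x i = S / 2 := by
    intro i
    have := (Finset.sum_eq_zero_iff_of_nonneg fun i _ => h0 i).1 hsum i (Finset.mem_univ i)
    rcases mul_eq_zero.1 this with h | h
    · exact absurd h (hpos i).ne'
    · linarith
  have h2 : S = 4 * (S / 2) := by
    conv_lhs => rw [hS, Fin.sum_univ_four, h1 0, h1 1, h1 2, h1 3]
    ring
  linarith [hpos 0, h1 0]

/-! ### Curvatures of the circles tangent to a fixed circle -/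

lemma sum_of_distinct (x : Fin 4 → ℝ) {o i j k : Fin 4} (h : [o, i, j, k].Nodup) :
    ∑ m, x m = x o + x i + x j + x k := by
  have hu : ∀ o i j k : Fin 4, [o, i, j, k].Nodup → Finset.univ = {o, i, j, k} := by decide
  rw [hu o i j k h]
  simp only [List.nodup_cons, List.mem_cons, List.not_mem_nil, or_false, not_or] at h
  rw [Finset.sum_insert (by simp; tauto), Finset.sum_insert (by simp; tauto),
    Finset.sum_pair h.2.2.1]
  ring

/-- The quadruple `q` realizes the binary quadratic form `A x² + 2 B x y + C y²`: the first circle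
has curvature `a`, and the other ones have curvatures the values of the form at `(1, 0)`, `(0, 1)`
and `(1, 1)`, each diminished by `a`. -/
def Realizes (q : Fin 4 → OrientedCircle) (a A B C : ℤ) : Prop :=
  ∃ o i j k : Fin 4, [o, i, j, k].Nodup ∧ curvatures q o = a ∧ curvatures q i = A - a ∧
    curvatures q j = C - a ∧ curvatures q k = A + 2 * B + C - a

lemma Realizes.symm {q : Fin 4 → OrientedCircle} {a A B C : ℤ} (h : Realizes q a A B C) :
    Realizes q a C B A := by
  obtain ⟨o, i, j, k, hn, h0, h1, h2, h3⟩ := h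
  refine ⟨o, j, i, k, ?_, h0, h2, h1, by rw [h3]; ring⟩
  simp only [List.nodup_cons, List.mem_cons, List.not_mem_nil, or_false, not_or] at hn ⊢
  tauto

section

variable {D q : Fin 4 → OrientedCircle} {a A B C : ℤ}

/-- The change of basis `(e₁, e₂) ↦ (e₁, e₁ + e₂)` is an exchange. -/
lemma Realizes.exists_add (hD : IsDescartes D) (hq : Reachable D q) (h : Realizes q a A B C) :
    ∃ q', Reachable D q' ∧ Realizes q' a A (A + B) (A + 2 * B + C) := by
  obtain ⟨o, i, j, k, hn, h0, h1, h2, h3⟩ := h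
  obtain ⟨q', hq', -, hc⟩ := hq.exists_exchange hD j
  have hs := sum_of_distinct (curvatures q) hn
  have hn' := hn
  simp only [List.nodup_cons, List.mem_cons, List.not_mem_nil, or_false, not_or] at hn'
  refine ⟨q', hq', o, i, k, j, ?_, ?_, ?_, ?_, ?_⟩
  · simp only [List.nodup_cons, List.mem_cons, List.not_mem_nil, or_false, not_or]
    tauto
  · rw [hc, exchange_of_ne (by tauto), h0]
  · rw [hc, exchange_of_ne (by tauto), h1]
  · rw [hc, exchange_of_ne (by tauto), h3]
    push_cast
    ring
  · rw [hc, exchange_self, hs, h0, h1, h2, h3]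
    push_cast
    ring

/-- The change of basis `(e₁, e₂) ↦ (e₁, -e₂)` is an exchange. -/
lemma Realizes.exists_neg (hD : IsDescartes D) (hq : Reachable D q) (h : Realizes q a A B C) :
    ∃ q', Reachable D q' ∧ Realizes q' a A (-B) C := by
  obtain ⟨o, i, j, k, hn, h0, h1, h2, h3⟩ := h
  obtain ⟨q', hq', -, hc⟩ := hq.exists_exchange hD k
  have hs := sum_of_distinct (curvatures q) hn
  have hn' := hn
  simp only [List.nodup_cons, List.mem_cons, List.not_mem_nil, or_false, not_or] at hn'
  refine ⟨q', hq', o, i, j, k, hn, ?_, ?_, ?_, ?_⟩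
  · rw [hc, exchange_of_ne (by tauto), h0]
  · rw [hc, exchange_of_ne (by tauto), h1]
  · rw [hc, exchange_of_ne (by tauto), h2]
  · rw [hc, exchange_self, hs, h0, h1, h2, h3]
    push_cast
    ring

/-- Euclid's algorithm on `(x, y)`, carried out by exchanges. -/
lemma Realizes.exists_curvature_nat (hD : IsDescartes D) (n : ℕ) : ∀ {x y : ℕ}, x + y = n →
    x.Coprime y → ∀ {q : Fin 4 → OrientedCircle} {A B C : ℤ}, Reachable D q →
    Realizes q a A B C → ∃ c ∈ apollonianPacking D,
      c.curvature = ((A * x ^ 2 + 2 * B * x * y + C * y ^ 2 - a : ℤ) : ℝ) := by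
  induction n using Nat.strong_induction_on with
  | _ n ih =>
  intro x y hn hxy q A B C hq h
  rcases Nat.eq_zero_or_pos x with hx | hx
  · subst hx
    obtain rfl : y = 1 := by simpa using hxy
    obtain ⟨o, i, j, k, -, -, -, h2, -⟩ := h
    exact ⟨q j, ⟨q, hq, j, rfl⟩, h2.trans (by push_cast; ring)⟩
  rcases Nat.eq_zero_or_pos y with hy | hy
  · subst hy
    obtain rfl : x = 1 := by simpa using hxy
    obtain ⟨o, i, j, k, -, -, h1, -, -⟩ := h
    exact ⟨q i, ⟨q, hq, i, rfl⟩, h1.trans (by push_cast; ring)⟩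
  rcases lt_trichotomy x y with hlt | heq | hlt
  · obtain ⟨q', hq', h'⟩ := h.symm.exists_add hD hq
    obtain ⟨c, hc, e⟩ := ih (y - x + x) (by omega) rfl
      ((Nat.coprime_sub_self_left hlt.le).2 hxy.symm) hq' h'
    refine ⟨c, hc, e.trans ?_⟩
    push_cast [Nat.cast_sub hlt.le]
    ring
  · subst heq
    obtain rfl : x = 1 := by simpa using hxy
    obtain ⟨o, i, j, k, -, -, -, -, h3⟩ := h
    exact ⟨q k, ⟨q, hq, k, rfl⟩, h3.trans (by push_cast; ring)⟩
  · obtain ⟨q', hq', h'⟩ := h.exists_add hD hq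
    obtain ⟨c, hc, e⟩ := ih (x - y + y) (by omega) rfl
      ((Nat.coprime_sub_self_left hlt.le).2 hxy) hq' h'
    refine ⟨c, hc, e.trans ?_⟩
    push_cast [Nat.cast_sub hlt.le]
    ring

lemma Realizes.exists_curvature (hD : IsDescartes D) (hq : Reachable D q)
    (h : Realizes q a A B C) {x y : ℤ} (hxy : IsCoprime x y) : ∃ c ∈ apollonianPacking D,
      c.curvature = ((A * x ^ 2 + 2 * B * x * y + C * y ^ 2 - a : ℤ) : ℝ) := by
  have hco : x.natAbs.Coprime y.natAbs := Int.isCoprime_iff_gcd_eq_one.1 hxy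
  have hx2 : ((x.natAbs : ℤ)) ^ 2 = x ^ 2 := Int.natAbs_sq x
  have hy2 : ((y.natAbs : ℤ)) ^ 2 = y ^ 2 := Int.natAbs_sq y
  have hm : ((x.natAbs : ℤ)) * y.natAbs = |x * y| := by
    rw [abs_mul, Int.natCast_natAbs, Int.natCast_natAbs]
  rcases le_total 0 (x * y) with h0 | h0
  · obtain ⟨c, hc, e⟩ := h.exists_curvature_nat hD _ rfl hco hq
    refine ⟨c, hc, e.trans (congrArg _ ?_)⟩
    rw [abs_of_nonneg h0] at hm
    linear_combination A * hx2 + C * hy2 + 2 * B * hm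
  · obtain ⟨q', hq', h'⟩ := h.exists_neg hD hq
    obtain ⟨c, hc, e⟩ := h'.exists_curvature_nat hD _ rfl hco hq'
    refine ⟨c, hc, e.trans (congrArg _ ?_)⟩
    rw [abs_of_nonpos h0] at hm
    linear_combination A * hx2 + C * hy2 - 2 * B * hm

end

/-- A Descartes configuration with integer curvatures realizes a form of determinant `a²`. -/
lemma IsDescartes.exists_realizes {D : Fin 4 → OrientedCircle} (hD : IsDescartes D)
    (hint : ∀ i, ∃ n : ℤ, (D i).curvature = n) :
    ∃ a A B C : ℤ, a ≠ 0 ∧ 0 < A ∧ A * C - B ^ 2 = a ^ 2 ∧ Realizes D a A B C := by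
  obtain ⟨o, ho⟩ := hD.exists_curvature_ne_zero
  have hex : ∀ o : Fin 4, ∃ i j k : Fin 4, [o, i, j, k].Nodup := by decide
  obtain ⟨i, j, k, hn⟩ := hex o
  choose n hn' using hint
  have hd := hD.sq_sum
  have hs := sum_of_distinct (curvatures D) hn
  have hs2 := sum_of_distinct (fun m => curvatures D m ^ 2) hn
  simp only [curvatures] at hs hs2
  rw [hs, hs2] at hd
  simp only [hn'] at hd
  norm_cast at hd
  have ha : n o ≠ 0 := fun h => ho (by rw [hn', h]; simp)
  set a := n o
  have heven : Even (n k - a - n i - n j) := by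
    have : Even ((n k - a - n i - n j) ^ 2) :=
      ⟨2 * (a * n i + a * n j + n i * n j), by linear_combination -hd⟩
    exact (Int.even_pow.1 this).1
  obtain ⟨B, hB⟩ := heven
  have hnk : n k = 2 * B + a + n i + n j := by linarith
  have hdet : (a + n i) * (a + n j) - B ^ 2 = a ^ 2 := by
    rw [hnk] at hd
    have : 4 * ((a + n i) * (a + n j) - B ^ 2) = 4 * a ^ 2 := by linear_combination hd
    linarith
  have hoi : o ≠ i := by
    simp only [List.nodup_cons, List.mem_cons, List.not_mem_nil, or_false, not_or] at hn
    tauto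
  have hA : 0 ≤ a + n i := by
    have := (hD hoi).curvature_add_nonneg
    rw [hn', hn'] at this
    exact_mod_cast this
  refine ⟨a, a + n i, B, a + n j, ha, lt_of_le_of_ne hA ?_, hdet, o, i, j, k, hn, hn' o, ?_, ?_, ?_⟩
  · intro h0
    rw [← h0] at hdet
    have : 0 < a ^ 2 := by positivity
    nlinarith [sq_nonneg B]
  · simp [curvatures, hn']
  · simp [curvatures, hn']
  · simp only [curvatures, hn', hnk]
    push_cast
    ring

/-- The form `A x² + 2 B x y + C y²` of determinant `a²` takes the value `A (u² + a² v²)` at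
`(u - B v, A v)`, and this vector is primitive if `u` and `v` are coprime and `u² + a² v²` is prime
to `A`. -/
lemma exists_curvature_eq_mul_norm {D : Fin 4 → OrientedCircle} (hD : IsDescartes D)
    (hint : ∀ i, ∃ n : ℤ, (D i).curvature = n) :
    ∃ a A : ℤ, a ≠ 0 ∧ 0 < A ∧ ∀ u v : ℤ, IsCoprime u v → IsCoprime (u ^ 2 + a ^ 2 * v ^ 2) A →
      ∃ c ∈ apollonianPacking D, c.curvature = ((A * (u ^ 2 + a ^ 2 * v ^ 2) - a : ℤ) : ℝ) := by
  obtain ⟨a, A, B, C, ha, hA, hdet, h⟩ := hD.exists_realizes hint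
  refine ⟨a, A, ha, hA, fun u v huv hco => ?_⟩
  have hcop : IsCoprime (u - B * v) (A * v) := by
    refine IsCoprime.mul_right ?_ ?_
    · have e : u ^ 2 + a ^ 2 * v ^ 2 = (u - B * v) * (u + B * v) + A * (C * v ^ 2) := by
        linear_combination -v ^ 2 * hdet
      rw [e] at hco
      exact (IsCoprime.add_mul_left_left_iff.1 hco).of_mul_left_left
    · have : u = (u - B * v) + B * v := by ring
      rw [this] at huv
      exact IsCoprime.add_mul_right_left_iff.1 huv
  obtain ⟨c, hc, e⟩ := h.exists_curvature hD .base hcop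
  refine ⟨c, hc, e.trans (congrArg _ ?_)⟩
  linear_combination A * v ^ 2 * hdet

/-! ### Primes congruent to one modulo four -/

/-- The nontrivial Dirichlet character modulo `4`, with real values. -/
noncomputable def chi (n : ℕ) : ℝ := (ZMod.χ₄ n : ℤ)

lemma chi_eq (n : ℕ) : chi n = if n % 2 = 0 then 0 else if n % 4 = 1 then 1 else -1 := by
  rw [chi, ZMod.χ₄_nat_eq_if_mod_four]
  split_ifs <;> simp

lemma chi_mul (m n : ℕ) : chi (m * n) = chi m * chi n := by
  rw [chi, chi, chi, Nat.cast_mul, map_mul, Int.cast_mul]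

lemma abs_chi_le (n : ℕ) : |chi n| ≤ 1 := by
  rw [chi_eq]
  split_ifs <;> simp

lemma sum_chi (N : ℕ) :
    ∑ n ∈ Finset.Ioc 0 N, chi n = if N % 4 = 1 ∨ N % 4 = 2 then 1 else 0 := by
  induction N with
  | zero => simp
  | succ N ih =>
    rw [Finset.sum_Ioc_succ_top (Nat.zero_le N), ih, chi_eq]
    split_ifs <;> first | (exfalso; omega) | norm_num

lemma abs_sum_chi_le {m N : ℕ} (h : m ≤ N) : |∑ n ∈ Finset.Ioc m N, chi n| ≤ 1 := by
  have := Finset.sum_Ioc_consecutive chi (Nat.zero_le m) h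
  rw [sum_chi, sum_chi] at this
  rw [← eq_sub_iff_add_eq'] at this
  rw [this]
  split_ifs <;> simp

/-- Abel summation against the bounded partial sums of `chi`. -/
lemma abs_sum_chi_mul_le {g : ℕ → ℝ} {m : ℕ} (hg : ∀ n, m < n → g (n + 1) ≤ g n)
    (hg0 : ∀ n, m < n → 0 ≤ g n) (N : ℕ) :
    |∑ n ∈ Finset.Ioc m N, chi n * g n| ≤ g (m + 1) := by
  rcases le_or_gt N m with h | h
  · rw [Finset.Ioc_eq_empty (by omega)]
    simpa using hg0 (m + 1) (by omega)
  have key : |∑ n ∈ Finset.Ioc m N, chi n * g n - (∑ n ∈ Finset.Ioc m N, chi n) * g N| ≤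
      g (m + 1) - g N := by
    induction N, h using Nat.le_induction with
    | base => simp
    | succ N hN ih =>
      have hmN : m < N := hN
      rw [Finset.sum_Ioc_succ_top hmN.le, Finset.sum_Ioc_succ_top hmN.le]
      have h1 := abs_sum_chi_le hmN.le
      set T := ∑ n ∈ Finset.Ioc m N, chi n
      have h2 : |T * (g N - g (N + 1))| ≤ g N - g (N + 1) := by
        rw [abs_mul, abs_of_nonneg (sub_nonneg.2 (hg N hmN))]
        exact mul_le_of_le_one_left (sub_nonneg.2 (hg N hmN)) h1
      have h3 := abs_add_le (∑ n ∈ Finset.Ioc m N, chi n * g n - T * g N) (T * (g N - g (N + 1)))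
      have h4 : ∑ n ∈ Finset.Ioc m N, chi n * g n + chi (N + 1) * g (N + 1) -
          (T + chi (N + 1)) * g (N + 1) =
          ∑ n ∈ Finset.Ioc m N, chi n * g n - T * g N + T * (g N - g (N + 1)) := by ring
      rw [h4]
      linarith
  have h1 := abs_sum_chi_le h.le
  set T := ∑ n ∈ Finset.Ioc m N, chi n
  have h2 : |T * g N| ≤ g N := by
    rw [abs_mul, abs_of_nonneg (hg0 N h)]
    exact mul_le_of_le_one_left (hg0 N h) h1
  have h3 := abs_add_le (∑ n ∈ Finset.Ioc m N, chi n * g n - T * g N) (T * g N)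
  rw [sub_add_cancel] at h3
  linarith

/-- Partial sums of `L(1, χ₄)`. -/
noncomputable def lOne (N : ℕ) : ℝ := ∑ n ∈ Finset.Ioc 0 N, chi n * (1 / (n : ℝ))

lemma abs_lOne_sub_le {k N : ℕ} (h : k ≤ N) : |lOne N - lOne k| ≤ 1 / ((k : ℝ) + 1) := by
  have e : lOne N - lOne k = ∑ n ∈ Finset.Ioc k N, chi n * (1 / (n : ℝ)) := by
    rw [lOne, lOne, ← Finset.sum_Ioc_consecutive _ (Nat.zero_le k) h]
    ring
  rw [e]
  have := abs_sum_chi_mul_le (g := fun n => 1 / (n : ℝ)) (m := k)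
    (fun n hn => by
      have : (0 : ℝ) < n := by exact_mod_cast (by omega : 0 < n)
      push_cast
      exact one_div_le_one_div_of_le this (by linarith))
    (fun n _ => by positivity) N
  push_cast at this
  exact this

lemma half_le_lOne {N : ℕ} (h : 1 ≤ N) : 1 / 2 ≤ lOne N := by
  have h1 := abs_lOne_sub_le h
  have h2 : lOne 1 = 1 := by simp [lOne, chi_eq]
  rw [h2] at h1
  have := abs_le.1 h1
  norm_num at this
  linarith [this.1]

lemma abs_sum_chi_mul_log_le (N : ℕ) :
    |∑ n ∈ Finset.Ioc 0 N, chi n * (Real.log n / n)| ≤ 1 := by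
  have h := abs_sum_chi_mul_le (g := fun n => Real.log n / (n : ℝ)) (m := 2)
    (fun n hn => by
      have h3 : (3 : ℝ) ≤ n := by exact_mod_cast hn
      have he : Real.exp 1 < 3 := Real.exp_one_lt_three
      refine Real.log_div_self_antitoneOn (show Real.exp 1 ≤ (n : ℝ) by linarith)
        (show Real.exp 1 ≤ ((n + 1 : ℕ) : ℝ) by push_cast; linarith) ?_
      push_cast
      linarith)
    (fun n _ => div_nonneg (Real.log_natCast_nonneg n) (Nat.cast_nonneg n)) N
  have h3 : Real.log ((2 + 1 : ℕ) : ℝ) / ((2 + 1 : ℕ) : ℝ) ≤ 1 := by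
    have := Real.log_le_sub_one_of_pos (show (0 : ℝ) < 3 by norm_num)
    norm_num
    linarith
  have e : ∑ n ∈ Finset.Ioc 0 N, chi n * (Real.log n / n) =
      ∑ n ∈ Finset.Ioc 2 N, chi n * (Real.log n / n) := by
    symm
    refine Finset.sum_subset (Finset.Ioc_subset_Ioc_left (by norm_num)) fun n hn hn' => ?_
    rw [Finset.mem_Ioc] at hn hn'
    have : n = 1 ∨ n = 2 := by omega
    rcases this with rfl | rfl <;> simp [chi_eq]
  rw [e]
  exact h.trans h3

open ArithmeticFunction (vonMangoldt)

lemma sum_vonMangoldt_le (N : ℕ) :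
    ∑ d ∈ Finset.Ioc 0 N, vonMangoldt d ≤ (Real.log 4 + 4) * N := by
  have := Chebyshev.psi_le_const_mul_self (x := N) (Nat.cast_nonneg N)
  rwa [Chebyshev.psi, Nat.floor_natCast] at this

/-- Writing `log n = ∑ Λ(d)` in `∑ χ₄(n) log n / n`. -/
lemma sum_chi_mul_log_eq (N : ℕ) :
    ∑ n ∈ Finset.Ioc 0 N, chi n * (Real.log n / n) =
      ∑ d ∈ Finset.Ioc 0 N, chi d * vonMangoldt d / d * lOne (N / d) := by
  let f : ArithmeticFunction ℝ := ⟨fun n => chi n * vonMangoldt n / n, by simp⟩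
  let g : ArithmeticFunction ℝ := ⟨fun n => chi n * (1 / (n : ℝ)), by simp⟩
  have h := ArithmeticFunction.sum_Ioc_mul_eq_sum_sum f g N
  have h2 : ∀ n ∈ Finset.Ioc 0 N, (f * g) n = chi n * (Real.log n / n) := by
    intro n hn
    rw [← ArithmeticFunction.vonMangoldt_sum,
      ← Nat.sum_divisorsAntidiagonal (fun d _ => vonMangoldt d),
      ArithmeticFunction.mul_apply, Finset.sum_div, Finset.mul_sum]
    refine Finset.sum_congr rfl fun x hx => ?_
    have hx' := (Nat.mem_divisorsAntidiagonal.1 hx).1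
    simp only [f, g, ArithmeticFunction.coe_mk]
    rw [← hx', chi_mul]
    push_cast
    ring
  rw [← Finset.sum_congr rfl h2, h]
  rfl

/-- The partial sums of `∑ χ₄(d) Λ(d) / d` are bounded: in the preceding identity `lOne (N / d)` may
be replaced by `lOne N ≥ 1 / 2`, at the cost of `∑ Λ(d) / N`, which Chebyshev's bound controls. -/
lemma abs_sum_chi_mul_vonMangoldt_le (N : ℕ) :
    |∑ d ∈ Finset.Ioc 0 N, chi d * vonMangoldt d / d| ≤ 2 * (Real.log 4 + 5) := by
  have hlog4 : 0 ≤ Real.log 4 := Real.log_nonneg (by norm_num)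
  rcases Nat.eq_zero_or_pos N with rfl | hN
  · simp only [Finset.Ioc_self, Finset.sum_empty, abs_zero]
    linarith
  set E := ∑ d ∈ Finset.Ioc 0 N, chi d * vonMangoldt d / d with hE
  have hN' : (0 : ℝ) < N := by exact_mod_cast hN
  have h1 : |E * lOne N - ∑ d ∈ Finset.Ioc 0 N, chi d * vonMangoldt d / d * lOne (N / d)| ≤
      Real.log 4 + 4 := by
    rw [hE, Finset.sum_mul, ← Finset.sum_sub_distrib]
    calc _ ≤ ∑ d ∈ Finset.Ioc 0 N, vonMangoldt d / N := by
          refine (Finset.abs_sum_le_sum_abs _ _).trans (Finset.sum_le_sum fun d hd => ?_)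
          rw [Finset.mem_Ioc] at hd
          have hd0 : (0 : ℝ) < d := by exact_mod_cast hd.1
          have hΛ : 0 ≤ vonMangoldt d := ArithmeticFunction.vonMangoldt_nonneg
          rw [← mul_sub, abs_mul, abs_div, abs_mul, abs_of_nonneg hΛ, abs_of_pos hd0]
          have h2 := abs_lOne_sub_le (Nat.div_le_self N d)
          have h3 : 1 / (((N / d : ℕ) : ℝ) + 1) ≤ d / N := by
            rw [div_le_div_iff₀ (by positivity) hN', one_mul]
            have : N < d * (N / d + 1) := Nat.lt_mul_div_succ N hd.1
            exact_mod_cast this.le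
          calc |chi d| * vonMangoldt d / d * |lOne N - lOne (N / d)|
              ≤ 1 * vonMangoldt d / d * (d / N) := by
                gcongr
                · exact abs_chi_le d
                · exact h2.trans h3
            _ = vonMangoldt d / N := by field_simp
      _ ≤ Real.log 4 + 4 := by
          rw [← Finset.sum_div, div_le_iff₀ hN']
          exact sum_vonMangoldt_le N
  rw [← sum_chi_mul_log_eq] at h1
  have h2 := abs_sum_chi_mul_log_le N
  have h3 : |E| * (1 / 2) ≤ |E * lOne N| := by
    rw [abs_mul]
    gcongr
    exact (half_le_lOne hN).trans (le_abs_self _)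
  have h4 := abs_sub_abs_le_abs_sub (E * lOne N) (∑ n ∈ Finset.Ioc 0 N, chi n * (Real.log n / n))
  linarith

lemma sum_log_eq (N : ℕ) :
    ∑ n ∈ Finset.Ioc 0 N, Real.log n = ∑ d ∈ Finset.Ioc 0 N, vonMangoldt d * ((N / d : ℕ) : ℝ) := by
  rw [← ArithmeticFunction.sum_Ioc_mul_zeta_eq_sum, ArithmeticFunction.vonMangoldt_mul_zeta]
  rfl

lemma le_sum_log {N : ℕ} (hN : 1 ≤ N) :
    N * Real.log N - N ≤ ∑ n ∈ Finset.Ioc 0 N, Real.log n := by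
  have h := Real.pow_div_factorial_le_exp (N : ℝ) (Nat.cast_nonneg N) N
  have hN' : (0 : ℝ) < N := by exact_mod_cast hN
  have hf : (0 : ℝ) < N.factorial := by exact_mod_cast N.factorial_pos
  have e : ∑ n ∈ Finset.Ioc 0 N, Real.log n = Real.log N.factorial := by
    clear h hN hN' hf
    induction N with
    | zero => simp
    | succ N ih =>
      rw [Finset.sum_Ioc_succ_top (Nat.zero_le N), ih, Nat.factorial_succ, Nat.cast_mul,
        Real.log_mul (by positivity) (by positivity), add_comm]
  have := Real.log_le_log (by positivity) h
  rw [Real.log_exp, Real.log_div (by positivity) hf.ne', Real.log_pow] at this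
  linarith

/-- Lower bound in **Mertens' first theorem**. -/
lemma le_sum_vonMangoldt_div {N : ℕ} (hN : 1 ≤ N) :
    Real.log N - 1 ≤ ∑ d ∈ Finset.Ioc 0 N, vonMangoldt d / d := by
  have hN' : (0 : ℝ) < N := by exact_mod_cast hN
  have h1 : ∑ d ∈ Finset.Ioc 0 N, vonMangoldt d * ((N / d : ℕ) : ℝ) ≤
      N * ∑ d ∈ Finset.Ioc 0 N, vonMangoldt d / d := by
    rw [Finset.mul_sum]
    refine Finset.sum_le_sum fun d _ => ?_
    calc vonMangoldt d * ((N / d : ℕ) : ℝ) ≤ vonMangoldt d * (N / d) := by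
          gcongr
          exact Nat.cast_div_le
      _ = N * (vonMangoldt d / d) := by ring
  have h2 := le_sum_log hN
  rw [sum_log_eq] at h2
  refine le_of_mul_le_mul_left ?_ hN'
  linarith

/-- Upper bound in **Mertens' first theorem**. -/
lemma sum_vonMangoldt_div_le {N : ℕ} (hN : 1 ≤ N) :
    ∑ d ∈ Finset.Ioc 0 N, vonMangoldt d / d ≤ Real.log N + (Real.log 4 + 4) := by
  have hN' : (0 : ℝ) < N := by exact_mod_cast hN
  have h1 : N * ∑ d ∈ Finset.Ioc 0 N, vonMangoldt d / d ≤
      ∑ d ∈ Finset.Ioc 0 N, vonMangoldt d * ((N / d : ℕ) : ℝ) +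
        ∑ d ∈ Finset.Ioc 0 N, vonMangoldt d := by
    rw [Finset.mul_sum, ← Finset.sum_add_distrib]
    refine Finset.sum_le_sum fun d hd => ?_
    rw [Finset.mem_Ioc] at hd
    have hd0 : (0 : ℝ) < d := by exact_mod_cast hd.1
    have h3 : (N : ℝ) / d ≤ ((N / d : ℕ) : ℝ) + 1 := by
      rw [div_le_iff₀ hd0, mul_comm]
      exact_mod_cast (Nat.lt_mul_div_succ N hd.1).le
    calc N * (vonMangoldt d / d) = vonMangoldt d * (N / d) := by ring
      _ ≤ vonMangoldt d * (((N / d : ℕ) : ℝ) + 1) := by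
          gcongr
      _ = _ := by ring
  have h2 : ∑ n ∈ Finset.Ioc 0 N, Real.log n ≤ N * Real.log N := by
    calc _ ≤ ∑ n ∈ Finset.Ioc 0 N, Real.log N := by
          refine Finset.sum_le_sum fun n hn => ?_
          rw [Finset.mem_Ioc] at hn
          exact Real.log_le_log (by exact_mod_cast hn.1) (by exact_mod_cast hn.2)
      _ = _ := by simp
  rw [sum_log_eq] at h2
  have h3 := sum_vonMangoldt_le N
  refine le_of_mul_le_mul_left ?_ hN'
  linarith

/-- The sum of `(1 + χ₄(d)) Λ(d)` over `d ≤ N` grows linearly: by Mertens' theorem and its analogue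
for `χ₄`, the sum of `(1 + χ₄(d)) Λ(d) / d` over the window `N / K < d ≤ N` is `log K + O(1)`. -/
lemma exists_le_sum_one_add_chi_mul_vonMangoldt :
    ∃ K : ℕ, 0 < K ∧ ∀ N : ℕ, K ≤ N →
      2 * (N : ℝ) / K ≤ ∑ d ∈ Finset.Ioc 0 N, (1 + chi d) * vonMangoldt d := by
  -- the sum of the error terms in the three bounds applied at both ends of the window
  set C : ℝ := (Real.log 4 + 4) + 1 + 4 * (Real.log 4 + 5)
  obtain ⟨K, hK⟩ := exists_nat_ge (Real.exp (C + 2))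
  have hK0 : (0 : ℝ) < K := (Real.exp_pos _).trans_le hK
  have hlogK : C + 2 ≤ Real.log K := (Real.le_log_iff_exp_le hK0).2 hK
  have hKn : 0 < K := by exact_mod_cast hK0
  refine ⟨K, hKn, fun N hN => ?_⟩
  have hN0 : 0 < N := by omega
  have hN' : (0 : ℝ) < N := by exact_mod_cast hN0
  have hM : 1 ≤ N / K := Nat.div_pos hN hKn
  set M := N / K with hMdef
  have hsplit : ∀ L : ℕ, ∑ d ∈ Finset.Ioc 0 L, (1 + chi d) * vonMangoldt d / d =
      ∑ d ∈ Finset.Ioc 0 L, vonMangoldt d / d +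
        ∑ d ∈ Finset.Ioc 0 L, chi d * vonMangoldt d / d := by
    intro L
    rw [← Finset.sum_add_distrib]
    exact Finset.sum_congr rfl fun d _ => by ring
  have hnn : ∀ d, 0 ≤ (1 + chi d) * vonMangoldt d := fun d =>
    mul_nonneg (by linarith [(abs_le.1 (abs_chi_le d)).1]) ArithmeticFunction.vonMangoldt_nonneg
  have hwin : 2 ≤ ∑ d ∈ Finset.Ioc M N, (1 + chi d) * vonMangoldt d / d := by
    have h1 := Finset.sum_Ioc_consecutive (fun d : ℕ => (1 + chi d) * vonMangoldt d / d)
      (Nat.zero_le M) (Nat.div_le_self N K)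
    rw [hsplit, hsplit] at h1
    have h2 := le_sum_vonMangoldt_div hN0
    have h3 := sum_vonMangoldt_div_le hM
    have h4 := (abs_le.1 (abs_sum_chi_mul_vonMangoldt_le N)).1
    have h5 := (abs_le.1 (abs_sum_chi_mul_vonMangoldt_le M)).2
    have h6 : Real.log M ≤ Real.log N - Real.log K := by
      rw [← Real.log_div hN'.ne' hK0.ne']
      exact Real.log_le_log (by exact_mod_cast hM) Nat.cast_div_le
    linarith
  calc 2 * (N : ℝ) / K = N / K * 2 := by ring
    _ ≤ N / K * ∑ d ∈ Finset.Ioc M N, (1 + chi d) * vonMangoldt d / d := by gcongr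
    _ ≤ ∑ d ∈ Finset.Ioc M N, (1 + chi d) * vonMangoldt d := by
        rw [Finset.mul_sum]
        refine Finset.sum_le_sum fun d hd => ?_
        rw [Finset.mem_Ioc] at hd
        have hd0 : (0 : ℝ) < d := by exact_mod_cast (by omega : 0 < d)
        have h1 : (N : ℝ) / K ≤ d := by
          rw [div_le_iff₀ hK0]
          have : N < K * (N / K + 1) := Nat.lt_mul_div_succ N hKn
          have h2 : K * (N / K + 1) ≤ K * d := Nat.mul_le_mul_left _ hd.1
          have h3 : N ≤ d * K := by rw [mul_comm d K]; omega
          exact_mod_cast h3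
        calc N / K * ((1 + chi d) * vonMangoldt d / d)
            ≤ d * ((1 + chi d) * vonMangoldt d / d) := by
              gcongr
              exact div_nonneg (hnn d) hd0.le
          _ = (1 + chi d) * vonMangoldt d := by field_simp
    _ ≤ _ := Finset.sum_le_sum_of_subset_of_nonneg
        (Finset.Ioc_subset_Ioc_left (Nat.zero_le M)) fun d _ _ => hnn d

/-- The primes congruent to `1` modulo `4` that do not divide `Q`. -/
def SplitPrime (Q p : ℕ) : Prop := p.Prime ∧ p % 4 = 1 ∧ ¬ p ∣ Q

open scoped Classical in
/-- The primes `p ≤ N` with `p ≡ 1 mod 4` and `p ∤ Q`. -/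
noncomputable def splitPrimes (Q N : ℕ) : Finset ℕ := (Finset.Ioc 0 N).filter (SplitPrime Q)

lemma mem_splitPrimes {Q N p : ℕ} :
    p ∈ splitPrimes Q N ↔ p ∈ Finset.Ioc 0 N ∧ SplitPrime Q p := by
  classical exact Finset.mem_filter

/-- A Chebyshev lower bound for the primes congruent to `1` modulo `4` prime to `Q`. -/
lemma exists_le_sum_log_splitPrime {Q : ℕ} (hQ : Q ≠ 0) : ∃ c : ℝ, 0 < c ∧ ∃ N₀ : ℕ, 0 < N₀ ∧
    ∀ N : ℕ, N₀ ≤ N → c * N ≤ ∑ p ∈ splitPrimes Q N, Real.log p := by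
  obtain ⟨K, hK, h⟩ := exists_le_sum_one_add_chi_mul_vonMangoldt
  obtain ⟨C, hC⟩ := Chebyshev.psi_sub_theta_le_mul_sqrt
  have hK' : (0 : ℝ) < K := by exact_mod_cast hK
  set B : ℝ := Real.log 2 + ∑ p ∈ Q.divisors, Real.log p with hB
  have hB0 : 0 ≤ B := add_nonneg (Real.log_nonneg (by norm_num))
    (Finset.sum_nonneg fun p _ => Real.log_natCast_nonneg p)
  obtain ⟨N₁, hN₁⟩ := exists_nat_ge ((2 * K * (|C| + B)) ^ 2)
  refine ⟨1 / (2 * K), by positivity, max N₁ K, lt_max_of_lt_right hK, fun N hN => ?_⟩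
  have hs : ∀ p, p ∈ splitPrimes Q N ↔ _ := fun p => mem_splitPrimes
  set s := splitPrimes Q N
  have hKN : K ≤ N := (le_max_right _ _).trans hN
  have hN1 : (1 : ℝ) ≤ N := by exact_mod_cast (by omega : 1 ≤ N)
  have hsqrt1 : 1 ≤ Real.sqrt N := Real.one_le_sqrt.2 hN1
  have hsq : Real.sqrt N * Real.sqrt N = N := Real.mul_self_sqrt (by linarith)
  have hs2 : 2 * K * (|C| + B) ≤ Real.sqrt N := by
    refine Real.le_sqrt_of_sq_le (hN₁.trans ?_)
    exact_mod_cast (le_max_left _ _).trans hN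
  -- prime powers, the prime `2` and the divisors of `Q` contribute little
  have hterm : ∀ d ∈ Finset.Ioc 0 N, (1 + chi d) * vonMangoldt d ≤
      (if ¬ d.Prime then 2 * vonMangoldt d else 0) + (if d = 2 then Real.log d else 0) +
      (if d ∈ Q.divisors then 2 * Real.log d else 0) + (if d ∈ s then 2 * Real.log d else 0) := by
    intro d hd
    have hΛ : 0 ≤ vonMangoldt d := ArithmeticFunction.vonMangoldt_nonneg
    have hl : 0 ≤ Real.log d := Real.log_natCast_nonneg d
    have i2 : 0 ≤ (if d = 2 then Real.log d else 0) := by split_ifs <;> simp [hl]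
    have i3 : 0 ≤ (if d ∈ Q.divisors then 2 * Real.log d else 0) := by split_ifs <;> simp [hl]
    have i4 : 0 ≤ (if d ∈ s then 2 * Real.log d else 0) := by split_ifs <;> simp [hl]
    have hchi := (abs_le.1 (abs_chi_le d)).2
    by_cases hp : d.Prime
    · rw [if_neg (not_not.2 hp), ArithmeticFunction.vonMangoldt_apply_prime hp]
      rcases hp.eq_two_or_odd with rfl | hodd
      · have : chi 2 = 0 := by simp [chi_eq]
        rw [this, if_pos rfl]
        linarith
      · by_cases h4 : d % 4 = 1
        · by_cases hdQ : d ∣ Q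
          · rw [if_pos (Nat.mem_divisors.2 ⟨hdQ, hQ⟩)]
            nlinarith
          · rw [if_pos ((hs d).2 ⟨hd, hp, h4, hdQ⟩)]
            nlinarith
        · have : chi d = -1 := by rw [chi_eq, if_neg (by omega), if_neg h4]
          rw [this]
          linarith
    · rw [if_pos hp]
      nlinarith
  have hsum := (h N hKN).trans (Finset.sum_le_sum hterm)
  rw [Finset.sum_add_distrib, Finset.sum_add_distrib, Finset.sum_add_distrib,
    ← Finset.sum_filter, ← Finset.sum_filter, ← Finset.sum_filter, ← Finset.sum_filter,
    ← Finset.mul_sum, ← Finset.mul_sum, ← Finset.mul_sum] at hsum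
  have h1 : ∑ d ∈ Finset.Ioc 0 N with ¬ d.Prime, vonMangoldt d ≤ |C| * Real.sqrt N := by
    have e := Chebyshev.psi_sub_theta_eq_sum_not_prime (N : ℝ)
    rw [Nat.floor_natCast] at e
    rw [← e]
    exact (hC N).trans (by gcongr; exact le_abs_self C)
  have h2 : ∑ d ∈ Finset.Ioc 0 N with d = 2, Real.log d ≤ 2 * Real.log 2 := by
    have hl : 0 ≤ Real.log 2 := Real.log_nonneg (by norm_num)
    rw [Finset.filter_eq']
    split_ifs <;> simp <;> linarith
  have h3 : ∑ d ∈ Finset.Ioc 0 N with d ∈ Q.divisors, Real.log d ≤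
      ∑ p ∈ Q.divisors, Real.log p :=
    Finset.sum_le_sum_of_subset_of_nonneg (fun d hd => (Finset.mem_filter.1 hd).2)
      fun d _ _ => Real.log_natCast_nonneg d
  have h4 : (Finset.Ioc 0 N).filter (· ∈ s) = s := by
    ext p
    rw [Finset.mem_filter]
    exact ⟨fun hp => hp.2, fun hp => ⟨((hs p).1 hp).1, hp⟩⟩
  rw [h4] at hsum
  have h5 : (N : ℝ) / K ≤ |C| * Real.sqrt N + B + ∑ p ∈ s, Real.log p := by
    rw [hB]
    have : 2 * (N : ℝ) / K = 2 * (N / K) := by ring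
    linarith
  have h6 : |C| * Real.sqrt N + B ≤ 1 / (2 * K) * N := by
    have h7 : |C| * Real.sqrt N + B ≤ (|C| + B) * Real.sqrt N := by nlinarith
    have h8 : (|C| + B) * Real.sqrt N * (2 * K) ≤ N := by nlinarith
    rw [one_div, inv_mul_eq_div, le_div_iff₀ (by positivity)]
    nlinarith
  have h9 : (N : ℝ) / K = 1 / (2 * K) * N + 1 / (2 * K) * N := by
    field_simp
    norm_num
  linarith

/-! ### Primitive sums of two squares -/

/-- The positive integers all of whose prime factors are congruent to `1` modulo `4` and prime to
`Q`. -/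
def SplitNumber (Q n : ℕ) : Prop := 0 < n ∧ ∀ p, p.Prime → p ∣ n → SplitPrime Q p

open scoped Classical in
/-- The split numbers `n ≤ N`. -/
noncomputable def splitNumbers (Q N : ℕ) : Finset ℕ := (Finset.Ioc 0 N).filter (SplitNumber Q)

lemma mem_splitNumbers {Q N n : ℕ} :
    n ∈ splitNumbers Q N ↔ n ∈ Finset.Ioc 0 N ∧ SplitNumber Q n := by
  classical exact Finset.mem_filter

lemma SplitNumber.of_dvd {Q m n : ℕ} (h : SplitNumber Q n) (hm : m ∣ n) : SplitNumber Q m :=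
  ⟨Nat.pos_of_dvd_of_pos hm h.1, fun p hp hpm => h.2 p hp (hpm.trans hm)⟩

lemma SplitNumber.mul_prime {Q n p : ℕ} (h : SplitNumber Q n) (hp : SplitPrime Q p) :
    SplitNumber Q (p * n) := by
  refine ⟨Nat.mul_pos hp.1.pos h.1, fun l hl hln => ?_⟩
  rcases hl.dvd_mul.1 hln with h1 | h1
  · rwa [(Nat.prime_dvd_prime_iff_eq hl hp.1).1 h1]
  · exact h.2 l hl h1

lemma SplitNumber.coprime {Q n : ℕ} (h : SplitNumber Q n) : n.Coprime Q :=
  Nat.Coprime.symm <| Nat.coprime_of_dvd fun p hp hQ hn => (h.2 p hp hn).2.2 hQ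

lemma not_isCoprime_iff {x y : ℤ} :
    ¬ IsCoprime x y ↔ ∃ l : ℕ, l.Prime ∧ (l : ℤ) ∣ x ∧ (l : ℤ) ∣ y := by
  rw [Int.isCoprime_iff_gcd_eq_one]
  constructor
  · intro h
    obtain ⟨l, hl, hd⟩ := Nat.exists_prime_and_dvd h
    exact ⟨l, hl, (Int.natCast_dvd_natCast.2 hd).trans (Int.gcd_dvd_left ..),
      (Int.natCast_dvd_natCast.2 hd).trans (Int.gcd_dvd_right ..)⟩
  · rintro ⟨l, hl, hx, hy⟩ h
    have := Int.dvd_coe_gcd hx hy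
    rw [h] at this
    exact hl.one_lt.ne' (Nat.dvd_one.1 (by exact_mod_cast this))

/-- A primitive representation of `n` as a sum of two squares, multiplied by a Gaussian prime or by
its conjugate, gives a primitive representation of `p n`. -/
lemma exists_primitive_mul_prime {p : ℕ} (hp : p.Prime) (h4 : p % 4 = 1) {x y : ℤ}
    (hxy : IsCoprime x y) :
    ∃ x' y' : ℤ, IsCoprime x' y' ∧ x' ^ 2 + y' ^ 2 = p * (x ^ 2 + y ^ 2) := by
  have := Fact.mk hp
  obtain ⟨a, b, hab⟩ := Nat.Prime.sq_add_sq (p := p) (by omega)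
  obtain ⟨u, hu⟩ : ∃ u : ℤ, u = a := ⟨_, rfl⟩
  obtain ⟨v, hv⟩ : ∃ v : ℤ, v = b := ⟨_, rfl⟩
  have huv : u ^ 2 + v ^ 2 = p := by rw [hu, hv]; exact_mod_cast hab
  have hpZ : Prime (p : ℤ) := Nat.prime_iff_prime_int.1 hp
  obtain ⟨s, t, hst⟩ := hxy
  by_contra! hc
  -- a common prime factor of the coordinates of a product can only be `p`
  have key : ∀ v : ℤ, u ^ 2 + v ^ 2 = p → ¬ IsCoprime (x * u - y * v) (x * v + y * u) →
      (p : ℤ) ∣ x * u - y * v ∧ (p : ℤ) ∣ x * v + y * u := by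
    intro v huv hn
    obtain ⟨l, hl, h1, h2⟩ := not_isCoprime_iff.1 hn
    have h3 : (l : ℤ) ∣ p := by
      have e : (p : ℤ) = s * ((x * u - y * v) * u + (x * v + y * u) * v) +
          t * ((x * v + y * u) * u - (x * u - y * v) * v) := by
        linear_combination -p * hst - (s * x + t * y) * huv
      rw [e]
      exact dvd_add (((h1.mul_right _).add (h2.mul_right _)).mul_left _)
        (((h2.mul_right _).sub (h1.mul_right _)).mul_left _)
    have : l = p := (Nat.prime_dvd_prime_iff_eq hl hp).1 (Int.natCast_dvd_natCast.1 h3)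
    rw [← this]
    exact ⟨h1, h2⟩
  obtain ⟨h1, h2⟩ := key v huv fun h => hc _ _ h (by linear_combination (x ^ 2 + y ^ 2) * huv)
  obtain ⟨h3, h4'⟩ := key (-v) (by rw [neg_sq, huv]) fun h =>
    hc _ _ h (by linear_combination (x ^ 2 + y ^ 2) * huv)
  have hodd : ∀ k : ℤ, (p : ℤ) ∣ 2 * k → (p : ℤ) ∣ k := by
    intro k hk
    refine (hpZ.dvd_or_dvd hk).resolve_left fun h => ?_
    have := Nat.le_of_dvd (by norm_num) (Int.natCast_dvd_natCast.1 h)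
    have := hp.two_le
    interval_cases p
    omega
  have hxu : (p : ℤ) ∣ x * u := hodd _ (by
    have := dvd_add h1 h3
    ring_nf at this ⊢
    exact this)
  have hyv : (p : ℤ) ∣ y * v := hodd _ (by
    have := dvd_sub h3 h1
    ring_nf at this ⊢
    exact this)
  have hyu : (p : ℤ) ∣ y * u := hodd _ (by
    have := dvd_add h2 h4'
    ring_nf at this ⊢
    exact this)
  have hxv : (p : ℤ) ∣ x * v := hodd _ (by
    have := dvd_sub h2 h4'
    ring_nf at this ⊢
    exact this)
  have hpu : (p : ℤ) ∣ u := by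
    have : u = s * (x * u) + t * (y * u) := by linear_combination -u * hst
    rw [this]
    exact dvd_add (hxu.mul_left _) (hyu.mul_left _)
  have hpv : (p : ℤ) ∣ v := by
    have : v = s * (x * v) + t * (y * v) := by linear_combination -v * hst
    rw [this]
    exact dvd_add (hxv.mul_left _) (hyv.mul_left _)
  have hp2 : (p : ℤ) ^ 2 ∣ p := by
    conv_rhs => rw [← huv]
    exact dvd_add (pow_dvd_pow_of_dvd hpu 2) (pow_dvd_pow_of_dvd hpv 2)
  have hp2' : p ^ 2 ∣ p := by exact_mod_cast hp2
  have := Nat.le_of_dvd hp.pos hp2'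
  nlinarith [hp.two_le]

lemma SplitNumber.exists_primitive {Q n : ℕ} (h : SplitNumber Q n) :
    ∃ x y : ℤ, IsCoprime x y ∧ x ^ 2 + y ^ 2 = n := by
  induction n using induction_on_primes with
  | zero => exact absurd h.1 (lt_irrefl 0)
  | one => exact ⟨1, 0, isCoprime_one_left, by norm_num⟩
  | prime_mul p n hp ih =>
    obtain ⟨x, y, hxy, e⟩ := ih (h.of_dvd (Dvd.intro_left p rfl))
    obtain ⟨x', y', hxy', e'⟩ :=
      exists_primitive_mul_prime hp (h.2 p hp (Dvd.intro n rfl)).2.1 hxy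
    exact ⟨x', y', hxy', by rw [e', e]; push_cast; ring⟩

lemma splitNumber_of_primitive {Q n : ℕ} (hQ : 2 ∣ Q) {x y : ℤ} (hxy : IsCoprime x y)
    (hn : (n : ℤ) = x ^ 2 + y ^ 2) (hnQ : n.Coprime Q) : SplitNumber Q n := by
  have hn0 : n ≠ 0 := by
    rintro rfl
    have h1 : x = 0 := by push_cast at hn; nlinarith [sq_nonneg x, sq_nonneg y]
    have h2 : y = 0 := by push_cast at hn; nlinarith [sq_nonneg x, sq_nonneg y]
    rw [h1, h2] at hxy
    exact not_isCoprime_zero_zero hxy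
  refine ⟨Nat.pos_of_ne_zero hn0, fun p hp hpn => ?_⟩
  have hpQ : ¬ p ∣ Q := fun h => Nat.Prime.not_coprime_iff_dvd.2 ⟨p, hp, hpn, h⟩ hnQ
  have h3 : p % 4 ≠ 3 := Nat.mod_four_ne_three_of_mem_primeFactors_of_isSquare_neg_one
    (Nat.mem_primeFactors.2 ⟨hp, hpn, hn0⟩)
    (by simpa using ZMod.isSquare_neg_one_of_eq_sq_add_sq_of_isCoprime hn hxy)
  have h2 : p ≠ 2 := by rintro rfl; exact hpQ hQ
  have := hp.eq_two_or_odd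
  exact ⟨hp, by omega, hpQ⟩

/-! ### The number of primitive representations -/

section GaussianInt

open Zsqrtd

lemma GaussianInt.isUnit_of_isUnit_norm {z : GaussianInt} (h : IsUnit (Zsqrtd.norm z)) :
    IsUnit z := by
  rw [← Zsqrtd.norm_eq_one_iff]
  exact Int.isUnit_iff_natAbs_eq.1 h

lemma GaussianInt.isUnit_gcd_iff {z w : GaussianInt} :
    IsUnit (EuclideanDomain.gcd z w) ↔ IsCoprime z w := EuclideanDomain.gcd_isUnit_iff

lemma GaussianInt.star_dvd {z w : GaussianInt} (h : z ∣ star w) : star z ∣ w := by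
  obtain ⟨c, hc⟩ := h
  refine ⟨star c, ?_⟩
  rw [← star_star w, hc, star_mul, mul_comm]

/-- Two divisors of a primitive Gaussian integer that have the same norm are associated. -/
lemma GaussianInt.dvd_of_norm_eq {z δ ε : GaussianInt}
    (hz : ∀ k : ℤ, (k : GaussianInt) ∣ z → IsUnit k) (hδ : δ ∣ z) (hε : ε ∣ z)
    (h : Zsqrtd.norm δ = Zsqrtd.norm ε) : ε ∣ δ := by
  obtain ⟨w, rfl⟩ := hδ
  have hco : IsCoprime w (star δ) := by
    rw [← isUnit_gcd_iff]
    refine isUnit_of_isUnit_norm (hz _ ?_)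
    rw [Zsqrtd.norm_eq_mul_conj, mul_comm]
    exact mul_dvd_mul (star_dvd (EuclideanDomain.gcd_dvd_right _ _))
      (EuclideanDomain.gcd_dvd_left _ _)
  obtain ⟨a, b, hab⟩ := hco
  have h2 : ε ∣ δ * star δ := by
    rw [← Zsqrtd.norm_eq_mul_conj, h, Zsqrtd.norm_eq_mul_conj]
    exact dvd_mul_right _ _
  have e : δ = a * (δ * w) + b * (δ * star δ) := by linear_combination -δ * hab
  rw [e]
  exact dvd_add (hε.mul_left _) (h2.mul_left _)

lemma GaussianInt.associated_of_dvd {z w : GaussianInt} (h : z ∣ w) (hw : Zsqrtd.norm z ≠ 0)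
    (hn : Zsqrtd.norm z = Zsqrtd.norm w) : Associated z w := by
  obtain ⟨c, rfl⟩ := h
  rw [Zsqrtd.norm_mul] at hn
  have : Zsqrtd.norm c = 1 := mul_left_cancel₀ hw (by linarith)
  exact associated_mul_unit_right z c (isUnit_of_isUnit_norm (by rw [this]; exact isUnit_one))

/-- If `z₀ = δ w` with `δ = gcd(z, z₀)` and `z` has the norm of `z₀`, then `z` is `δ w̄` up to a
unit. -/
lemma GaussianInt.associated_gcd_mul_star {z z₀ w : GaussianInt} (h0 : Zsqrtd.norm z₀ ≠ 0)
    (hn : Zsqrtd.norm z = Zsqrtd.norm z₀) (hw : z₀ = EuclideanDomain.gcd z z₀ * w) :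
    Associated z (EuclideanDomain.gcd z z₀ * star w) := by
  set δ := EuclideanDomain.gcd z z₀ with hδ
  obtain ⟨v, hv⟩ := EuclideanDomain.gcd_dvd_left z z₀
  rw [← hδ] at hv
  have hδ0 : Zsqrtd.norm δ ≠ 0 := by
    intro h
    rw [hw, Zsqrtd.norm_mul, h, zero_mul] at h0
    exact h0 rfl
  have hδ0' : δ ≠ 0 := by
    rintro h
    rw [h, Zsqrtd.norm_zero] at hδ0
    exact hδ0 rfl
  have hnorm : Zsqrtd.norm v = Zsqrtd.norm w := by
    rw [hv, hw, Zsqrtd.norm_mul, Zsqrtd.norm_mul] at hn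
    exact mul_left_cancel₀ hδ0 hn
  have hco : IsCoprime v w := by
    have hb := EuclideanDomain.gcd_eq_gcd_ab z z₀
    rw [← hδ] at hb
    refine ⟨EuclideanDomain.gcdA z z₀, EuclideanDomain.gcdB z z₀, mul_left_cancel₀ hδ0' ?_⟩
    linear_combination -hb - EuclideanDomain.gcdA z z₀ * hv - EuclideanDomain.gcdB z z₀ * hw
  have hdvd : v ∣ star w := by
    refine hco.dvd_of_dvd_mul_left ?_
    rw [← Zsqrtd.norm_eq_mul_conj, ← hnorm, Zsqrtd.norm_eq_mul_conj]
    exact dvd_mul_right _ _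
  refine associated_of_dvd ?_ (hn ▸ h0) ?_
  · rw [hv]
    exact mul_dvd_mul_left δ hdvd
  · rw [hn, Zsqrtd.norm_mul, Zsqrtd.norm_conj, ← Zsqrtd.norm_mul, ← hw]

/-- Gaussian integers of the norm of a primitive `z₀` are determined up to units by the norm of
their greatest common divisor with `z₀`. -/
lemma GaussianInt.associated_of_norm_gcd_eq {z₀ z z' : GaussianInt}
    (hz₀ : ∀ k : ℤ, (k : GaussianInt) ∣ z₀ → IsUnit k) (h0 : Zsqrtd.norm z₀ ≠ 0)
    (hz : Zsqrtd.norm z = Zsqrtd.norm z₀) (hz' : Zsqrtd.norm z' = Zsqrtd.norm z₀)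
    (h : Zsqrtd.norm (EuclideanDomain.gcd z z₀) = Zsqrtd.norm (EuclideanDomain.gcd z' z₀)) :
    Associated z z' := by
  obtain ⟨w, hw⟩ := EuclideanDomain.gcd_dvd_right z z₀
  obtain ⟨w', hw'⟩ := EuclideanDomain.gcd_dvd_right z' z₀
  have h1 := associated_gcd_mul_star h0 hz hw
  have h2 := associated_gcd_mul_star h0 hz' hw'
  have h3 : Associated (EuclideanDomain.gcd z z₀) (EuclideanDomain.gcd z' z₀) :=
    associated_of_dvd_dvd
      (dvd_of_norm_eq hz₀ (EuclideanDomain.gcd_dvd_right z' z₀)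
        (EuclideanDomain.gcd_dvd_right z z₀) h.symm)
      (dvd_of_norm_eq hz₀ (EuclideanDomain.gcd_dvd_right z z₀)
        (EuclideanDomain.gcd_dvd_right z' z₀) h)
  have hne : EuclideanDomain.gcd z z₀ ≠ 0 := by
    intro hg
    rw [hg, zero_mul] at hw
    rw [hw, Zsqrtd.norm_zero] at h0
    exact h0 rfl
  have h4 : Associated w w' := by
    refine Associated.of_mul_left ?_ h3 hne
    rw [← hw, ← hw']
    exact Associated.refl z₀
  have h5 : Associated (star w) (star w') := by
    obtain ⟨u, hu⟩ := h4
    refine ⟨star u, ?_⟩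
    rw [← hu, star_mul, mul_comm]
    rfl
  exact h1.trans ((h3.mul_mul h5).trans h2.symm)

lemma GaussianInt.card_le_four {s : Finset GaussianInt} (h : ∀ z ∈ s, ∀ w ∈ s, Associated z w) :
    s.card ≤ 4 := by
  classical
  rcases s.eq_empty_or_nonempty with rfl | ⟨z, hz⟩
  · simp
  have hsub : s ⊆ ({1, -1, ⟨0, 1⟩, ⟨0, -1⟩} : Finset GaussianInt).image (z * ·) := by
    intro w hw
    obtain ⟨u, hu⟩ := h z hz w hw
    refine Finset.mem_image.2 ⟨u, ?_, hu⟩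
    have hn : Zsqrtd.norm (u : GaussianInt) = 1 := by
      have h1 := (Zsqrtd.norm_eq_one_iff (x := (u : GaussianInt))).2 u.isUnit
      have h2 := GaussianInt.norm_nonneg (u : GaussianInt)
      omega
    rw [Zsqrtd.norm_def] at hn
    have hr : (u : GaussianInt).re ^ 2 + (u : GaussianInt).im ^ 2 = 1 := by linarith
    obtain ⟨r, hr'⟩ : ∃ r, r = (u : GaussianInt).re := ⟨_, rfl⟩
    obtain ⟨m, hm'⟩ : ∃ m, m = (u : GaussianInt).im := ⟨_, rfl⟩
    rw [← hr', ← hm'] at hr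
    have r1 : r ≤ 1 := by nlinarith
    have r2 : -1 ≤ r := by nlinarith
    have m1 : m ≤ 1 := by nlinarith
    have m2 : -1 ≤ m := by nlinarith
    have hcases : r = 1 ∧ m = 0 ∨ r = -1 ∧ m = 0 ∨ r = 0 ∧ m = 1 ∨ r = 0 ∧ m = -1 := by
      clear hr' hm' hn
      interval_cases r <;> interval_cases m <;> simp at hr ⊢
    simp only [Finset.mem_insert, Finset.mem_singleton, Zsqrtd.ext_iff, ← hr', ← hm']
    simpa using hcases
  exact (Finset.card_le_card hsub).trans (Finset.card_image_le.trans Finset.card_le_four)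

end GaussianInt

/-- A positive integer `n` has at most `4 τ(n)` primitive representations as a sum of two
squares. -/
lemma card_primitive_le {n : ℕ} (hn : n ≠ 0) {s : Finset (ℕ × ℕ)}
    (hs : ∀ x ∈ s, x.1.Coprime x.2 ∧ x.1 ^ 2 + x.2 ^ 2 = n) : s.card ≤ 4 * n.divisors.card := by
  classical
  let g : ℕ × ℕ → GaussianInt := fun x => ⟨x.1, x.2⟩
  have hg : Function.Injective g := by
    rintro ⟨a, b⟩ ⟨c, d⟩ h
    simpa [g, Zsqrtd.ext_iff] using h
  have hnorm : ∀ x ∈ s, Zsqrtd.norm (g x) = n := by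
    intro x hx
    rw [← (hs x hx).2, Zsqrtd.norm_def]
    push_cast
    ring
  rcases s.eq_empty_or_nonempty with rfl | ⟨x₀, hx₀⟩
  · simp
  have hprim : ∀ k : ℤ, (k : GaussianInt) ∣ g x₀ → IsUnit k := by
    intro k hk
    rw [Zsqrtd.intCast_dvd] at hk
    exact (Nat.isCoprime_iff_coprime.2 (hs x₀ hx₀).1).isUnit_of_dvd' hk.1 hk.2
  have h0 : Zsqrtd.norm (g x₀) ≠ 0 := by rw [hnorm x₀ hx₀]; exact_mod_cast hn
  let f : ℕ × ℕ → ℕ := fun x => (Zsqrtd.norm (EuclideanDomain.gcd (g x) (g x₀))).natAbs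
  refine Finset.card_le_mul_card_image_of_maps_to (f := f) (t := n.divisors) ?_ 4 ?_
  · intro x _
    refine Nat.mem_divisors.2 ⟨?_, hn⟩
    obtain ⟨w, hw⟩ := EuclideanDomain.gcd_dvd_right (g x) (g x₀)
    have h1 : Zsqrtd.norm (EuclideanDomain.gcd (g x) (g x₀)) ∣ (n : ℤ) := by
      rw [← hnorm x₀ hx₀]
      conv_rhs => rw [hw, Zsqrtd.norm_mul]
      exact dvd_mul_right _ _
    exact Int.natAbs_dvd_natAbs.2 h1
  · intro d _
    rw [← Finset.card_image_of_injective _ hg]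
    refine GaussianInt.card_le_four ?_
    intro z hz w hw
    obtain ⟨x, hx, rfl⟩ := Finset.mem_image.1 hz
    obtain ⟨y, hy, rfl⟩ := Finset.mem_image.1 hw
    rw [Finset.mem_filter] at hx hy
    refine GaussianInt.associated_of_norm_gcd_eq hprim h0 ?_ ?_ ?_
    · rw [hnorm x hx.1, hnorm x₀ hx₀]
    · rw [hnorm y hy.1, hnorm x₀ hx₀]
    · have h1 := hx.2.trans hy.2.symm
      rw [← Int.natAbs_of_nonneg (GaussianInt.norm_nonneg (EuclideanDomain.gcd (g x) (g x₀))),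
        ← Int.natAbs_of_nonneg (GaussianInt.norm_nonneg (EuclideanDomain.gcd (g y) (g x₀)))]
      exact congrArg _ h1

/-! ### The sum of the reciprocals of the split numbers -/

/-- Split numbers have at most `4 τ(n)` primitive representations, and their divisors are split. -/
lemma sum_primitive_le (Q N : ℕ) {s : Finset (ℕ × ℕ)}
    (hs : ∀ x ∈ s, x.1.Coprime x.2 ∧ x.1 ^ 2 + x.2 ^ 2 ∈ splitNumbers Q N) :
    ∑ x ∈ s, 1 / ((x.1 ^ 2 + x.2 ^ 2 : ℕ) : ℝ) ≤
      4 * (∑ d ∈ splitNumbers Q N, 1 / (d : ℝ)) ^ 2 := by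
  classical
  set A := splitNumbers Q N with hA
  have h1 : ∀ n ∈ A, ∑ x ∈ s with x.1 ^ 2 + x.2 ^ 2 = n, 1 / ((x.1 ^ 2 + x.2 ^ 2 : ℕ) : ℝ) ≤
      4 * ∑ x ∈ ((A ×ˢ A).filter fun x => x.1 * x.2 ∈ A) with x.1 * x.2 = n,
        1 / (x.1 : ℝ) * (1 / (x.2 : ℝ)) := by
    intro n hn
    have hnA := mem_splitNumbers.1 hn
    have hn0 : n ≠ 0 := hnA.2.1.ne'
    calc ∑ x ∈ s with x.1 ^ 2 + x.2 ^ 2 = n, 1 / ((x.1 ^ 2 + x.2 ^ 2 : ℕ) : ℝ)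
        = (s.filter fun x => x.1 ^ 2 + x.2 ^ 2 = n).card * (1 / (n : ℝ)) := by
          rw [Finset.sum_congr rfl fun x hx => by rw [(Finset.mem_filter.1 hx).2],
            Finset.sum_const, nsmul_eq_mul]
      _ ≤ (4 * n.divisors.card : ℕ) * (1 / (n : ℝ)) := by
          gcongr
          refine card_primitive_le hn0 fun x hx => ?_
          rw [Finset.mem_filter] at hx
          exact ⟨(hs x hx.1).1, hx.2⟩
      _ = 4 * ∑ x ∈ n.divisorsAntidiagonal, 1 / (x.1 : ℝ) * (1 / (x.2 : ℝ)) := by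
          rw [Finset.sum_congr rfl fun x hx => by
              rw [div_mul_div_comm, one_mul, ← Nat.cast_mul,
                (Nat.mem_divisorsAntidiagonal.1 hx).1],
            Finset.sum_const, nsmul_eq_mul, ← Nat.map_div_right_divisors, Finset.card_map]
          push_cast
          ring
      _ ≤ _ := by
          gcongr
          intro x hx
          have hx' := (Nat.mem_divisorsAntidiagonal.1 hx).1
          have hmem : ∀ d, d ∣ n → d ∈ A := fun d hd => by
            have := hnA.2.of_dvd hd
            rw [hA, mem_splitNumbers, Finset.mem_Ioc]
            exact ⟨⟨this.1, (Nat.le_of_dvd hnA.2.1 hd).trans (Finset.mem_Ioc.1 hnA.1).2⟩, this⟩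
          rw [Finset.mem_filter, Finset.mem_filter, Finset.mem_product, hx']
          exact ⟨⟨⟨hmem _ (Dvd.intro _ hx'), hmem _ (Dvd.intro_left _ hx')⟩, hn⟩, rfl⟩
  rw [← Finset.sum_fiberwise_of_maps_to fun x hx => (hs x hx).2]
  refine (Finset.sum_le_sum h1).trans ?_
  rw [← Finset.mul_sum, Finset.sum_fiberwise_of_maps_to fun x hx => (Finset.mem_filter.1 hx).2,
    sq, Finset.sum_mul_sum, ← Finset.sum_product']
  gcongr
  exact Finset.filter_subset _ _

lemma sum_one_div_sq_le (m : ℕ) : ∑ g ∈ Finset.Ioc 0 m, 1 / (g : ℝ) ^ 2 ≤ 2 := by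
  rcases Nat.eq_zero_or_pos m with rfl | hm
  · simp
  have h := sum_Ioc_inv_sq_le_sub (α := ℝ) one_ne_zero hm
  rw [← Finset.sum_Ioc_consecutive _ (Nat.zero_le 1) hm]
  simp only [one_div]
  have h2 : (0 : ℝ) ≤ (m : ℝ)⁻¹ := by positivity
  simp at h ⊢
  linarith

/-- The lattice points `(1 + Q i, Q j)` with `j ≤ i` are multiples of primitive vectors whose norms
are split numbers, which bounds the sum of the reciprocals of their norms from above. -/
lemma sum_lattice_le {Q : ℕ} (hQ : 0 < Q) (h2 : 2 ∣ Q) {M N : ℕ} (hN : 2 * Q ^ 2 * M ^ 2 ≤ N) :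
    ∑ i ∈ Finset.range M, ∑ j ∈ Finset.range (i + 1),
      1 / (((1 + Q * i) ^ 2 + (Q * j) ^ 2 : ℕ) : ℝ) ≤
      8 * (∑ d ∈ splitNumbers Q N, 1 / (d : ℝ)) ^ 2 := by
  classical
  set A := splitNumbers Q N with hA
  let P : Finset (ℕ × ℕ) := (Finset.range (N + 1) ×ˢ Finset.range (N + 1)).filter
    fun x => x.1.Coprime x.2 ∧ x.1 ^ 2 + x.2 ^ 2 ∈ A
  let I : Finset (Σ _ : ℕ, ℕ) := (Finset.range M).sigma fun i => Finset.range (i + 1)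
  let gc : (Σ _ : ℕ, ℕ) → ℕ := fun x => Nat.gcd (1 + Q * x.1) (Q * x.2)
  let φ : (Σ _ : ℕ, ℕ) → ℕ × (ℕ × ℕ) :=
    fun x => (gc x, ((1 + Q * x.1) / gc x, (Q * x.2) / gc x))
  have hg0 : ∀ x, 0 < gc x := fun x => Nat.gcd_pos_of_pos_left _ (by positivity)
  have e1 : ∀ x, (φ x).1 * (φ x).2.1 = 1 + Q * x.1 := fun x =>
    Nat.mul_div_cancel' (Nat.gcd_dvd_left _ _)
  have e2 : ∀ x, (φ x).1 * (φ x).2.2 = Q * x.2 := fun x =>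
    Nat.mul_div_cancel' (Nat.gcd_dvd_right _ _)
  have hinj : Function.Injective φ := by
    rintro ⟨i, j⟩ ⟨i', j'⟩ h
    have h1 := e1 ⟨i, j⟩
    have h3 := e2 ⟨i, j⟩
    rw [h, e1] at h1
    rw [h, e2] at h3
    have h4 : i' = i := Nat.eq_of_mul_eq_mul_left hQ (Nat.add_left_cancel h1)
    have h5 : j' = j := Nat.eq_of_mul_eq_mul_left hQ h3
    rw [h4, h5]
  have hnorm : ∀ x, (φ x).1 ^ 2 * ((φ x).2.1 ^ 2 + (φ x).2.2 ^ 2) =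
      (1 + Q * x.1) ^ 2 + (Q * x.2) ^ 2 := fun x => by
    rw [← e1, ← e2]; ring
  have hle : ∀ x ∈ I, (1 + Q * x.1) ^ 2 + (Q * x.2) ^ 2 ≤ N := by
    intro x hx
    rw [Finset.mem_sigma, Finset.mem_range, Finset.mem_range] at hx
    refine le_trans ?_ hN
    have h3 : 1 + Q * x.1 ≤ Q * M := by
      have : Q * (x.1 + 1) ≤ Q * M := Nat.mul_le_mul_left _ hx.1
      nlinarith
    have h4 : Q * x.2 ≤ Q * M := Nat.mul_le_mul_left _ (by omega)
    have h5 := Nat.pow_le_pow_left h3 2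
    have h6 := Nat.pow_le_pow_left h4 2
    nlinarith
  have hmaps : ∀ x ∈ I, φ x ∈ Finset.Ioc 0 N ×ˢ P := by
    intro x hx
    have hx1 := hle x hx
    have hpos : 0 < (φ x).2.1 ^ 2 + (φ x).2.2 ^ 2 := by
      refine Nat.pos_of_ne_zero fun h => ?_
      have := hnorm x
      rw [h, mul_zero] at this
      have : 0 < (1 + Q * x.1) ^ 2 := by positivity
      omega
    have hcop : (φ x).2.1.Coprime (φ x).2.2 := Nat.coprime_div_gcd_div_gcd (hg0 x)
    have hnle : (φ x).2.1 ^ 2 + (φ x).2.2 ^ 2 ≤ N := by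
      refine le_trans ?_ (hnorm x ▸ hx1)
      exact Nat.le_mul_of_pos_left _ (pow_pos (hg0 x) 2)
    have hgle : (φ x).1 ≤ N := by
      have h3 : (φ x).1 ≤ (φ x).1 ^ 2 := Nat.le_self_pow two_ne_zero _
      have h4 : (φ x).1 ^ 2 ≤ (φ x).1 ^ 2 * ((φ x).2.1 ^ 2 + (φ x).2.2 ^ 2) :=
        Nat.le_mul_of_pos_right _ hpos
      rw [hnorm] at h4
      omega
    have hcQ : ((φ x).2.1 ^ 2 + (φ x).2.2 ^ 2).Coprime Q := by
      refine Nat.Coprime.coprime_dvd_left (Dvd.intro_left _ (hnorm x)) ?_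
      have : (1 + Q * x.1) ^ 2 + (Q * x.2) ^ 2 =
          1 + Q * (x.1 * (2 + Q * x.1) + Q * x.2 ^ 2) := by ring
      rw [this]
      simp
    have hsplit : SplitNumber Q ((φ x).2.1 ^ 2 + (φ x).2.2 ^ 2) :=
      splitNumber_of_primitive h2 (Nat.isCoprime_iff_coprime.2 hcop) (by push_cast; rfl) hcQ
    have h5 : (φ x).2.1 ≤ N := by nlinarith [Nat.le_self_pow two_ne_zero (φ x).2.1]
    have h6 : (φ x).2.2 ≤ N := by nlinarith [Nat.le_self_pow two_ne_zero (φ x).2.2]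
    refine Finset.mem_product.2 ⟨Finset.mem_Ioc.2 ⟨hg0 x, hgle⟩, Finset.mem_filter.2
      ⟨Finset.mem_product.2 ⟨Finset.mem_range.2 (by omega), Finset.mem_range.2 (by omega)⟩,
        hcop, ?_⟩⟩
    rw [hA, mem_splitNumbers, Finset.mem_Ioc]
    exact ⟨⟨hpos, hnle⟩, hsplit⟩
  let F : ℕ × (ℕ × ℕ) → ℝ := fun x => 1 / (x.1 : ℝ) ^ 2 * (1 / ((x.2.1 ^ 2 + x.2.2 ^ 2 : ℕ) : ℝ))
  calc ∑ i ∈ Finset.range M, ∑ j ∈ Finset.range (i + 1),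
        1 / (((1 + Q * i) ^ 2 + (Q * j) ^ 2 : ℕ) : ℝ)
      = ∑ x ∈ I, F (φ x) := by
        rw [Finset.sum_sigma']
        refine Finset.sum_congr rfl fun x _ => ?_
        simp only [F]
        rw [← hnorm x, div_mul_div_comm]
        push_cast
        rw [one_mul]
    _ = ∑ y ∈ I.image φ, F y := (Finset.sum_image fun x _ y _ h => hinj h).symm
    _ ≤ ∑ y ∈ Finset.Ioc 0 N ×ˢ P, F y := by
        refine Finset.sum_le_sum_of_subset_of_nonneg (Finset.image_subset_iff.2 hmaps)
          fun y _ _ => ?_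
        simp only [F]
        positivity
    _ = (∑ g ∈ Finset.Ioc 0 N, 1 / (g : ℝ) ^ 2) *
          ∑ x ∈ P, 1 / ((x.1 ^ 2 + x.2 ^ 2 : ℕ) : ℝ) := by
        rw [Finset.sum_mul_sum, ← Finset.sum_product']
    _ ≤ 2 * (4 * (∑ d ∈ A, 1 / (d : ℝ)) ^ 2) := by
        gcongr
        · exact sum_one_div_sq_le N
        · exact sum_primitive_le Q N fun x hx => (Finset.mem_filter.1 hx).2
    _ = _ := by ring

lemma le_sum_lattice {Q : ℕ} (hQ : 0 < Q) (M : ℕ) :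
    Real.log ((M : ℝ) + 1) / (2 * (Q : ℝ) ^ 2) ≤
    ∑ i ∈ Finset.range M, ∑ j ∈ Finset.range (i + 1),
      1 / (((1 + Q * i) ^ 2 + (Q * j) ^ 2 : ℕ) : ℝ) := by
  have hQ' : (0 : ℝ) < Q := by exact_mod_cast hQ
  have h1 : Real.log ((M : ℝ) + 1) ≤ ∑ i ∈ Finset.range M, 1 / ((i : ℝ) + 1) := by
    have := log_add_one_le_harmonic M
    rw [harmonic] at this
    push_cast at this
    simpa [one_div] using this
  calc Real.log ((M : ℝ) + 1) / (2 * (Q : ℝ) ^ 2)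
      ≤ (∑ i ∈ Finset.range M, 1 / ((i : ℝ) + 1)) / (2 * (Q : ℝ) ^ 2) := by gcongr
    _ ≤ _ := by
        rw [Finset.sum_div]
        refine Finset.sum_le_sum fun i _ => ?_
        calc 1 / ((i : ℝ) + 1) / (2 * (Q : ℝ) ^ 2)
            = ∑ j ∈ Finset.range (i + 1), 1 / (2 * (Q : ℝ) ^ 2 * ((i : ℝ) + 1) ^ 2) := by
              rw [Finset.sum_const, Finset.card_range, nsmul_eq_mul]
              push_cast
              field_simp
          _ ≤ _ := by
              refine Finset.sum_le_sum fun j hj => ?_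
              rw [Finset.mem_range] at hj
              have hle : (1 + Q * i) ^ 2 + (Q * j) ^ 2 ≤ 2 * Q ^ 2 * (i + 1) ^ 2 := by
                have h3 : 1 + Q * i ≤ Q * (i + 1) := by nlinarith
                have h4 : Q * j ≤ Q * (i + 1) := Nat.mul_le_mul_left _ (by omega)
                have h5 := Nat.pow_le_pow_left h3 2
                have h6 := Nat.pow_le_pow_left h4 2
                nlinarith
              have hle' : (((1 + Q * i) ^ 2 + (Q * j) ^ 2 : ℕ) : ℝ) ≤
                  2 * (Q : ℝ) ^ 2 * ((i : ℝ) + 1) ^ 2 := by exact_mod_cast hle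
              refine one_div_le_one_div_of_le ?_ hle'
              exact_mod_cast (by positivity : 0 < (1 + Q * i) ^ 2 + (Q * j) ^ 2)

/-- The sum of the reciprocals of the split numbers up to `N` is at least of order
`√(log N)`. -/
lemma log_le_sq_sum_splitNumbers {Q : ℕ} (hQ : 0 < Q) (h2 : 2 ∣ Q) {N : ℕ} (hN : 4 * Q ^ 4 ≤ N) :
    Real.log N / (64 * (Q : ℝ) ^ 2) ≤ (∑ d ∈ splitNumbers Q N, 1 / (d : ℝ)) ^ 2 := by
  have hQ' : (0 : ℝ) < Q := by exact_mod_cast hQ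
  have hN0 : 0 < N := lt_of_lt_of_le (by positivity) hN
  have hN' : (0 : ℝ) < N := by exact_mod_cast hN0
  set M := Nat.sqrt (N / (2 * Q ^ 2)) with hM
  have hM1 : 2 * Q ^ 2 * M ^ 2 ≤ N := by
    have h1 : M ^ 2 ≤ N / (2 * Q ^ 2) := Nat.sqrt_le' _
    calc 2 * Q ^ 2 * M ^ 2 ≤ 2 * Q ^ 2 * (N / (2 * Q ^ 2)) := Nat.mul_le_mul_left _ h1
      _ ≤ N := Nat.mul_div_le _ _
  have hM2 : N ≤ 2 * Q ^ 2 * (M + 1) ^ 2 := by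
    have h1 : N / (2 * Q ^ 2) < (M + 1) ^ 2 := Nat.lt_succ_sqrt' _
    have h3 : N < 2 * Q ^ 2 * (N / (2 * Q ^ 2) + 1) := Nat.lt_mul_div_succ N (by positivity)
    exact h3.le.trans (Nat.mul_le_mul_left _ h1)
  have hM3 : N ≤ (M + 1) ^ 4 := by
    have h1 : N * N ≤ (2 * Q ^ 2 * (M + 1) ^ 2) * (2 * Q ^ 2 * (M + 1) ^ 2) :=
      Nat.mul_le_mul hM2 hM2
    have h3 : N * N ≤ N * (M + 1) ^ 4 := by
      calc N * N ≤ 4 * Q ^ 4 * (M + 1) ^ 4 := by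
            calc _ ≤ _ := h1
              _ = _ := by ring
        _ ≤ N * (M + 1) ^ 4 := Nat.mul_le_mul_right _ hN
    exact Nat.le_of_mul_le_mul_left h3 hN0
  have hlog : Real.log N ≤ 4 * Real.log ((M : ℝ) + 1) := by
    have h1 : (N : ℝ) ≤ ((M : ℝ) + 1) ^ 4 := by exact_mod_cast hM3
    have h3 := Real.log_le_log hN' h1
    rw [Real.log_pow] at h3
    exact_mod_cast h3
  have h5 := (le_sum_lattice hQ M).trans (sum_lattice_le hQ h2 hM1)
  rw [div_le_iff₀ (by positivity)] at h5 ⊢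
  linarith

/-! ### The number of split numbers -/

/-- Chebyshev's argument: `∑ log n` over the split numbers `n ≤ N` is at least the sum of `log p`
over the factorizations `n = p m` with `p` a split prime and `m` a split number. -/
lemma sum_sum_log_splitPrimes_le (Q N N₀ : ℕ) :
    ∑ m ∈ splitNumbers Q (N / N₀), ∑ p ∈ splitPrimes Q (N / m), Real.log p ≤
      (splitNumbers Q N).card * Real.log N := by
  classical
  let F : (Σ _ : ℕ, ℕ) → ℝ := fun x => vonMangoldt x.2
  let φ : (Σ _ : ℕ, ℕ) → (Σ _ : ℕ, ℕ) := fun x => ⟨x.2 * x.1, x.2⟩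
  let T : Finset (Σ _ : ℕ, ℕ) := (splitNumbers Q (N / N₀)).sigma fun m => splitPrimes Q (N / m)
  have hT : ∀ x ∈ T, x.1 ∈ splitNumbers Q (N / N₀) ∧ x.2 ∈ splitPrimes Q (N / x.1) :=
    fun x hx => Finset.mem_sigma.1 hx
  have hinj : Set.InjOn φ T := by
    rintro ⟨m, p⟩ hx ⟨m', p'⟩ - h
    have h1 : p * m = p' * m' := congrArg Sigma.fst h
    have h2 : p = p' := congrArg Sigma.snd h
    subst h2
    have hp := (Finset.mem_Ioc.1 (mem_splitPrimes.1 (hT _ hx).2).1).1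
    rw [Nat.eq_of_mul_eq_mul_left hp h1]
  have hmaps : ∀ x ∈ T, φ x ∈ (splitNumbers Q N).sigma fun n => n.divisors := by
    intro x hx
    obtain ⟨h1, h2⟩ := hT x hx
    rw [mem_splitNumbers] at h1
    rw [mem_splitPrimes, Finset.mem_Ioc] at h2
    have h3 := h1.2.mul_prime h2.2
    have h4 : x.2 * x.1 ≤ N :=
      (Nat.mul_le_mul_right _ h2.1.2).trans (Nat.div_mul_le_self _ _)
    refine Finset.mem_sigma.2 ⟨?_, Nat.mem_divisors.2 ⟨dvd_mul_right _ _, h3.1.ne'⟩⟩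
    exact mem_splitNumbers.2 ⟨Finset.mem_Ioc.2 ⟨h3.1, h4⟩, h3⟩
  calc ∑ m ∈ splitNumbers Q (N / N₀), ∑ p ∈ splitPrimes Q (N / m), Real.log p
      = ∑ x ∈ T, F (φ x) := by
        rw [Finset.sum_sigma']
        refine Finset.sum_congr rfl fun x hx => ?_
        exact (ArithmeticFunction.vonMangoldt_apply_prime
          (mem_splitPrimes.1 (hT x hx).2).2.1).symm
    _ = ∑ y ∈ T.image φ, F y := (Finset.sum_image hinj).symm
    _ ≤ ∑ y ∈ (splitNumbers Q N).sigma fun n => n.divisors, F y :=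
        Finset.sum_le_sum_of_subset_of_nonneg (Finset.image_subset_iff.2 hmaps)
          fun y _ _ => ArithmeticFunction.vonMangoldt_nonneg
    _ = ∑ n ∈ splitNumbers Q N, Real.log n := by
        rw [Finset.sum_sigma]
        exact Finset.sum_congr rfl fun n _ => ArithmeticFunction.vonMangoldt_sum
    _ ≤ ∑ n ∈ splitNumbers Q N, Real.log N := by
        refine Finset.sum_le_sum fun n hn => ?_
        have := Finset.mem_Ioc.1 (mem_splitNumbers.1 hn).1
        exact Real.log_le_log (by exact_mod_cast this.1) (by exact_mod_cast this.2)
    _ = _ := by rw [Finset.sum_const, nsmul_eq_mul]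

/-- There are at least of order `N / √(log N)` split numbers up to `N`. -/
lemma exists_le_card_splitNumbers {Q : ℕ} (hQ : 0 < Q) (h2 : 2 ∣ Q) :
    ∃ c : ℝ, 0 < c ∧ ∃ N₁ : ℕ, 2 ≤ N₁ ∧ ∀ N : ℕ, N₁ ≤ N →
      c * (N / Real.sqrt (Real.log N)) ≤ (splitNumbers Q N).card := by
  obtain ⟨c, hc, N₀, hN₀, hθ⟩ := exists_le_sum_log_splitPrime hQ.ne'
  have hQ' : (0 : ℝ) < Q := by exact_mod_cast hQ
  refine ⟨c / (24 * Q), by positivity, 4 * N₀ ^ 2 + 4 * Q ^ 4 * N₀ + 2, by omega, fun N hN => ?_⟩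
  have hN2 : 2 ≤ N := by omega
  have hN' : (0 : ℝ) < N := by exact_mod_cast (by omega : 0 < N)
  have hlog : 0 < Real.log N := Real.log_pos (by exact_mod_cast (by omega : 1 < N))
  set k := N / N₀ with hk
  have hk1 : 2 * N₀ ≤ k := (Nat.le_div_iff_mul_le hN₀).2 (by
    have : 2 * N₀ * N₀ ≤ 4 * N₀ ^ 2 := by nlinarith
    omega)
  have hk2 : 4 * Q ^ 4 ≤ k := (Nat.le_div_iff_mul_le hN₀).2 (by omega)
  have hk3 : N ≤ k ^ 2 := by
    have h1 : N < N₀ * (k + 1) := Nat.lt_mul_div_succ N hN₀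
    nlinarith
  have hlogk : Real.log N ≤ 2 * Real.log k := by
    have h1 : (N : ℝ) ≤ (k : ℝ) ^ 2 := by exact_mod_cast hk3
    have h3 := Real.log_le_log hN' h1
    rw [Real.log_pow] at h3
    exact_mod_cast h3
  set L := ∑ d ∈ splitNumbers Q k, 1 / (d : ℝ) with hL
  have hL0 : 0 ≤ L := Finset.sum_nonneg fun d _ => by positivity
  have hL1 : Real.sqrt (Real.log N) / (12 * Q) ≤ L := by
    refine (sq_le_sq₀ (by positivity) hL0).1 ?_
    refine le_trans ?_ (log_le_sq_sum_splitNumbers hQ h2 hk2)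
    rw [div_pow, Real.sq_sqrt hlog.le, div_le_div_iff₀ (by positivity) (by positivity)]
    have : 0 < (Q : ℝ) ^ 2 := by positivity
    nlinarith
  have h3 : c * N / 2 * L ≤ (splitNumbers Q N).card * Real.log N := by
    refine le_trans ?_ (sum_sum_log_splitPrimes_le Q N N₀)
    rw [hL, Finset.mul_sum]
    refine Finset.sum_le_sum fun m hm => ?_
    have hm' := Finset.mem_Ioc.1 (mem_splitNumbers.1 hm).1
    have hm0 : (0 : ℝ) < m := by exact_mod_cast hm'.1
    have h4 : N₀ ≤ N / m := by
      rw [Nat.le_div_iff_mul_le hm'.1]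
      calc N₀ * m ≤ N₀ * k := Nat.mul_le_mul_left _ hm'.2
        _ ≤ N := Nat.mul_div_le _ _
    refine le_trans ?_ (hθ _ h4)
    have h5 : (N : ℝ) ≤ 2 * m * (N / m : ℕ) := by
      have h6 : N < m * (N / m + 1) := Nat.lt_mul_div_succ N hm'.1
      have h7 : N ≤ 2 * m * (N / m) := by
        have : m ≤ m * (N / m) := Nat.le_mul_of_pos_right _ (by omega)
        nlinarith
      exact_mod_cast h7
    calc c * N / 2 * (1 / (m : ℝ)) = c * (N / (2 * m)) := by field_simp
      _ ≤ c * (N / m : ℕ) := by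
          gcongr
          rw [div_le_iff₀ (by positivity)]
          linarith
  have hs0 : 0 < Real.sqrt (Real.log N) := Real.sqrt_pos.2 hlog
  have hss : Real.sqrt (Real.log N) * Real.sqrt (Real.log N) = Real.log N :=
    Real.mul_self_sqrt hlog.le
  have h8 : c * N / 2 * (Real.sqrt (Real.log N) / (12 * Q)) ≤
      (splitNumbers Q N).card * Real.log N := le_trans (by gcongr) h3
  refine le_of_mul_le_mul_right ?_ hlog
  refine le_trans (le_of_eq ?_) h8
  clear h8 hL1
  generalize Real.sqrt (Real.log N) = σ at *
  rw [← hss]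
  field_simp
  norm_num

/-! ### Integers occurring as curvatures -/

/-- The product of a primitive Gaussian integer with the conjugate of another one of coprime norm is
primitive. -/
lemma isCoprime_mul_conj {x y x₀ y₀ : ℤ} (h : IsCoprime x y) (h₀ : IsCoprime x₀ y₀)
    (hn : IsCoprime (x ^ 2 + y ^ 2) (x₀ ^ 2 + y₀ ^ 2)) :
    IsCoprime (x * x₀ + y * y₀) (y * x₀ - x * y₀) := by
  by_contra hc
  obtain ⟨l, hl, h1, h2⟩ := not_isCoprime_iff.1 hc
  obtain ⟨s, t, hst⟩ := h
  obtain ⟨s₀, t₀, hst₀⟩ := h₀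
  have e₀ : x₀ ^ 2 + y₀ ^ 2 = (x * x₀ + y * y₀) * (s * x₀ + t * y₀) +
      (y * x₀ - x * y₀) * (t * x₀ - s * y₀) := by
    linear_combination -(x₀ ^ 2 + y₀ ^ 2) * hst
  have e : x ^ 2 + y ^ 2 = (x * x₀ + y * y₀) * (s₀ * x + t₀ * y) +
      (y * x₀ - x * y₀) * (s₀ * y - t₀ * x) := by
    linear_combination -(x ^ 2 + y ^ 2) * hst₀
  refine not_isCoprime_iff.2 ⟨l, hl, ?_, ?_⟩ hn
  · rw [e]
    exact dvd_add (h1.mul_right _) (h2.mul_right _)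
  · rw [e₀]
    exact dvd_add (h1.mul_right _) (h2.mul_right _)

/-- Every residue class modulo `q` containing a primitive Gaussian integer of norm prime to `q` has
a chosen representative of this kind. -/
lemma exists_representatives (q : ℕ) : ∃ x₀ y₀ : ZMod q × ZMod q → ℤ,
    (∀ r, IsCoprime (x₀ r) (y₀ r)) ∧ (∀ r, IsCoprime (x₀ r ^ 2 + y₀ r ^ 2) (q : ℤ)) ∧
    ∀ x y : ℤ, IsCoprime x y → IsCoprime (x ^ 2 + y ^ 2) (q : ℤ) →
      (x₀ (x, y) : ZMod q) = x ∧ (y₀ (x, y) : ZMod q) = y := by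
  have h : ∀ r : ZMod q × ZMod q, ∃ x₀ y₀ : ℤ, IsCoprime x₀ y₀ ∧
      IsCoprime (x₀ ^ 2 + y₀ ^ 2) (q : ℤ) ∧ ∀ x y : ℤ, IsCoprime x y →
        IsCoprime (x ^ 2 + y ^ 2) (q : ℤ) → ((x : ZMod q), (y : ZMod q)) = r →
        (x₀ : ZMod q) = x ∧ (y₀ : ZMod q) = y := by
    intro r
    by_cases hr : ∃ x y : ℤ, IsCoprime x y ∧ IsCoprime (x ^ 2 + y ^ 2) (q : ℤ) ∧
        ((x : ZMod q), (y : ZMod q)) = r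
    · obtain ⟨x₀, y₀, h1, h2, h3⟩ := hr
      refine ⟨x₀, y₀, h1, h2, fun x y _ _ h => ?_⟩
      rw [← h, Prod.mk.injEq] at h3
      exact h3
    · refine ⟨1, 0, isCoprime_one_left, by simpa using isCoprime_one_left, fun x y h1 h2 h3 => ?_⟩
      exact absurd ⟨x, y, h1, h2, h3⟩ hr
  choose x₀ y₀ h1 h2 h3 using h
  exact ⟨x₀, y₀, h1, h2, fun x y hx hy => h3 _ x y hx hy rfl⟩

lemma finite_curvatures {D : Fin 4 → OrientedCircle} (hD : IsDescartes D)
    (hint : ∀ i, ∃ n : ℤ, (D i).curvature = n) (X : ℝ) :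
    {n : ℤ | (n : ℝ) < X ∧ ∃ C ∈ apollonianPacking D, C.curvature = n}.Finite := by
  obtain ⟨m, hm⟩ := exists_le_curvature hD hint
  refine (Set.finite_Icc ⌈m⌉ ⌈X⌉).subset ?_
  rintro n ⟨hn, C, hC, e⟩
  refine ⟨Int.ceil_le.2 (e ▸ hm C hC), ?_⟩
  exact_mod_cast hn.le.trans (Int.le_ceil X)

lemma card_le_kappa {D : Fin 4 → OrientedCircle} (hD : IsDescartes D)
    (hint : ∀ i, ∃ n : ℤ, (D i).curvature = n) {X : ℝ} {s : Finset ℤ}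
    (hs : ∀ n ∈ s, (n : ℝ) < X ∧ ∃ C ∈ apollonianPacking D, C.curvature = n) :
    s.card ≤ kappa (apollonianPacking D) X := by
  rw [← Set.ncard_coe_finset]
  exact Set.ncard_le_ncard (fun n hn => hs n hn) (finite_curvatures hD hint X)

/-- The number of curvatures is bounded below by the number of split numbers: a split number `n`
times one of finitely many norms is a norm from `ℤ[a i]`, hence yields a curvature. -/
lemma exists_card_splitNumbers_le_kappa {D : Fin 4 → OrientedCircle} (hD : IsDescartes D)
    (hint : ∀ i, ∃ n : ℤ, (D i).curvature = n) :
    ∃ Q k h b : ℕ, 0 < Q ∧ 2 ∣ Q ∧ 0 < k ∧ 0 < h ∧ ∀ (N : ℕ) (X : ℝ), (h : ℝ) * N + b < X →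
      (splitNumbers Q N).card ≤ k * kappa (apollonianPacking D) X := by
  classical
  obtain ⟨a, A, ha, hA, hcurv⟩ := exists_curvature_eq_mul_norm hD hint
  set q : ℕ := a.natAbs * A.natAbs with hq
  have hq0 : 0 < q := Nat.mul_pos (Int.natAbs_pos.2 ha) (Int.natAbs_pos.2 hA.ne')
  have : NeZero q := ⟨hq0.ne'⟩
  have haq : a ∣ (q : ℤ) := by
    rw [hq, Nat.cast_mul]
    exact (Int.dvd_natAbs.2 dvd_rfl).mul_right _
  have hAq : A ∣ (q : ℤ) := by
    rw [hq, Nat.cast_mul]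
    exact (Int.dvd_natAbs.2 dvd_rfl).mul_left _
  obtain ⟨x₀, y₀, hprim, hcop, hrep⟩ := exists_representatives q
  let ν : ZMod q × ZMod q → ℕ := fun r => (x₀ r ^ 2 + y₀ r ^ 2).natAbs
  have hν : ∀ r, (ν r : ℤ) = x₀ r ^ 2 + y₀ r ^ 2 := fun r =>
    Int.natAbs_of_nonneg (by positivity)
  have hν0 : ∀ r, 0 < ν r := by
    intro r
    refine Nat.pos_of_ne_zero fun h => ?_
    have h1 := hν r
    rw [h] at h1
    have hx : x₀ r = 0 := by push_cast at h1; nlinarith [sq_nonneg (x₀ r), sq_nonneg (y₀ r)]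
    have hy : y₀ r = 0 := by push_cast at h1; nlinarith [sq_nonneg (x₀ r), sq_nonneg (y₀ r)]
    have h2 := hprim r
    rw [hx, hy] at h2
    exact not_isCoprime_zero_zero h2
  set Q : ℕ := 2 * q * ∏ r, ν r with hQ
  have hQ0 : 0 < Q := Nat.mul_pos (by omega) (Finset.prod_pos fun r _ => hν0 r)
  have hqQ : q ∣ Q := ⟨2 * ∏ r, ν r, by rw [hQ]; ring⟩
  have hνQ : ∀ r, ν r ∣ Q := fun r => (Finset.dvd_prod_of_mem ν (Finset.mem_univ r)).mul_left _
  -- a primitive Gaussian integer of norm `n`, for every split number `n`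
  have hex : ∀ n : ℕ, ∃ x y : ℤ, SplitNumber Q n → IsCoprime x y ∧ x ^ 2 + y ^ 2 = n := by
    intro n
    by_cases hn : SplitNumber Q n
    · obtain ⟨x, y, h⟩ := hn.exists_primitive
      exact ⟨x, y, fun _ => h⟩
    · exact ⟨0, 0, fun h => absurd h hn⟩
  choose x y hxy using hex
  let cl : ℕ → ZMod q × ZMod q := fun n => (x n, y n)
  let f : ℕ → ℤ := fun n => A * (n * ν (cl n)) - a
  have hf : ∀ n, SplitNumber Q n → ∃ C ∈ apollonianPacking D, C.curvature = f n := by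
    intro n hn
    obtain ⟨hc, hnorm⟩ := hxy n hn
    have hnQ := hn.coprime
    have hnq : IsCoprime (n : ℤ) (q : ℤ) :=
      Nat.isCoprime_iff_coprime.2 (hnQ.coprime_dvd_right hqQ)
    obtain ⟨hx, hy⟩ := hrep (x n) (y n) hc (by rwa [hnorm])
    change (x₀ (cl n) : ZMod q) = x n at hx
    change (y₀ (cl n) : ZMod q) = y n at hy
    have hw := isCoprime_mul_conj hc (hprim (cl n)) (by
      rw [hnorm, ← hν]
      exact Nat.isCoprime_iff_coprime.2 (hnQ.coprime_dvd_right (hνQ _)))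
    -- `z` and its representative are congruent, so their product `z z̄₀` is real modulo `q`
    have hdvd : (q : ℤ) ∣ y n * x₀ (cl n) - x n * y₀ (cl n) := by
      rw [← ZMod.intCast_zmod_eq_zero_iff_dvd]
      push_cast
      rw [hx, hy]
      ring
    obtain ⟨v, hv⟩ := haq.trans hdvd
    rw [hv] at hw
    set u := x n * x₀ (cl n) + y n * y₀ (cl n) with hu
    have hN : u ^ 2 + a ^ 2 * v ^ 2 = n * ν (cl n) := by
      rw [hν, ← hnorm, ← mul_pow, ← hv, hu]
      ring
    obtain ⟨C, hC, e⟩ := hcurv u v hw.of_mul_right_right (by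
      rw [hN]
      refine IsCoprime.mul_left (hnq.of_isCoprime_of_dvd_right hAq) ?_
      rw [hν]
      exact (hcop _).of_isCoprime_of_dvd_right hAq)
    exact ⟨C, hC, by rw [e, hN]⟩
  set H : ℕ := ∑ r, ν r with hH
  have hνH : ∀ r, ν r ≤ H := fun r =>
    Finset.single_le_sum (fun r _ => Nat.zero_le (ν r)) (Finset.mem_univ r)
  have hH0 : 0 < H := (hν0 (0, 0)).trans_le (hνH _)
  refine ⟨Q, Fintype.card (ZMod q × ZMod q), A.natAbs * H, a.natAbs, hQ0,
    ⟨q * ∏ r, ν r, by rw [hQ]; ring⟩, Fintype.card_pos, Nat.mul_pos (Int.natAbs_pos.2 hA.ne') hH0,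
    fun N X hX => ?_⟩
  have hfib : ∀ m ∈ (splitNumbers Q N).image f,
      ((splitNumbers Q N).filter fun n => f n = m).card ≤ Fintype.card (ZMod q × ZMod q) := by
    intro m _
    refine Finset.card_le_card_of_injOn cl (fun _ _ => Finset.mem_coe.2 (Finset.mem_univ _)) ?_
    intro n hn n' hn' hcl
    have h1 := (Finset.mem_filter.1 hn).2.trans (Finset.mem_filter.1 hn').2.symm
    have h2 : A * ((n : ℤ) * ν (cl n)) = A * ((n' : ℤ) * ν (cl n)) := by
      have h3 : A * ((n : ℤ) * ν (cl n)) - a = A * ((n' : ℤ) * ν (cl n')) - a := h1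
      rw [← hcl] at h3
      linarith
    have h4 := mul_right_cancel₀ (by exact_mod_cast (hν0 (cl n)).ne') (mul_left_cancel₀ hA.ne' h2)
    exact_mod_cast h4
  refine (Finset.card_le_mul_card_image _ _ hfib).trans (Nat.mul_le_mul_left _ ?_)
  refine card_le_kappa hD hint fun m hm => ?_
  obtain ⟨n, hn, rfl⟩ := Finset.mem_image.1 hm
  rw [mem_splitNumbers, Finset.mem_Ioc] at hn
  refine ⟨lt_of_le_of_lt ?_ hX, hf n hn.2⟩
  have h1 : f n ≤ (A.natAbs * H : ℕ) * N + a.natAbs := by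
    have h2 : A * ((n : ℤ) * ν (cl n)) ≤ A * (N * H) := by
      have : (n : ℤ) * ν (cl n) ≤ N * H := by exact_mod_cast Nat.mul_le_mul hn.1.2 (hνH _)
      exact mul_le_mul_of_nonneg_left this hA.le
    have h3 : -a ≤ a.natAbs := by rw [Int.natCast_natAbs]; exact neg_le_abs a
    have h4 : ((A.natAbs : ℕ) : ℤ) = A := Int.natAbs_of_nonneg hA.le
    push_cast [h4]
    simp only [f]
    rw [Int.natCast_natAbs] at h3
    linarith
  refine (Int.cast_le (R := ℝ).2 h1).trans (le_of_eq ?_)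
  simp only [Int.cast_add, Int.cast_mul, Int.cast_natCast]

theorem proposition2p1 (P : Set OrientedCircle) (hP : IsIntegerPacking P) :
    ∃ c : ℝ, 0 < c ∧ ∀ X : ℝ, 2 ≤ X → c * (X / Real.sqrt (Real.log X)) ≤ (kappa P X : ℝ) := by
  obtain ⟨D, hD, hint, rfl⟩ := hP
  obtain ⟨Q, k, h, b, hQ, h2Q, hk, hh, hcard⟩ := exists_card_splitNumbers_le_kappa hD hint
  obtain ⟨c, hc, N₁, hN₁, hsplit⟩ := exists_le_card_splitNumbers hQ h2Q
  have hk' : (0 : ℝ) < k := by exact_mod_cast hk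
  have hh' : (1 : ℝ) ≤ h := by exact_mod_cast hh
  have hlog2 : 0 < Real.log 2 := Real.log_pos (by norm_num)
  set X₁ : ℝ := 2 * h * N₁ + 2 * b + 2 with hX₁
  have hX₁0 : 0 < X₁ := by positivity
  refine ⟨min (Real.sqrt (Real.log 2) / X₁) (c / (4 * h * k)), by positivity, fun X hX => ?_⟩
  have hlogX : Real.log 2 ≤ Real.log X := Real.log_le_log (by norm_num) hX
  have hs2 : 0 < Real.sqrt (Real.log 2) := Real.sqrt_pos.2 hlog2
  have hsX : Real.sqrt (Real.log 2) ≤ Real.sqrt (Real.log X) := Real.sqrt_le_sqrt hlogX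
  have hsX0 : 0 < Real.sqrt (Real.log X) := hs2.trans_le hsX
  have hq0 : 0 ≤ X / Real.sqrt (Real.log X) := by positivity
  rcases lt_or_ge X X₁ with hlt | hge
  · -- for bounded `X` one curvature less than `2` suffices
    obtain ⟨C, ⟨r, hr, i, rfl⟩, hC0⟩ := exists_curvature_nonpos hD hint
    obtain ⟨n, hn⟩ := hr.curvatures_int hD hint i
    have h1 : 1 ≤ kappa (apollonianPacking D) X := by
      refine le_trans (by simp) (card_le_kappa hD hint (s := {n}) fun m hm => ?_)
      rw [Finset.mem_singleton] at hm
      subst hm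
      refine ⟨?_, r i, ⟨r, hr, i, rfl⟩, hn⟩
      rw [← hn]
      exact lt_of_le_of_lt hC0 (by linarith)
    calc _ ≤ Real.sqrt (Real.log 2) / X₁ * (X / Real.sqrt (Real.log X)) := by
          gcongr
          exact min_le_left _ _
      _ = (Real.sqrt (Real.log 2) / Real.sqrt (Real.log X)) * (X / X₁) := by ring
      _ ≤ 1 * 1 := by
          gcongr
          · exact (div_le_one hsX0).2 hsX
          · exact (div_le_one hX₁0).2 hlt.le
      _ ≤ _ := by
          rw [one_mul]
          exact_mod_cast h1
  · set N : ℕ := ⌊X / (2 * h)⌋₊ with hN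
    have hXh : 0 ≤ X / (2 * h) := by positivity
    have hN1 : (N : ℝ) ≤ X / (2 * h) := Nat.floor_le hXh
    have hN2 : N₁ ≤ N := by
      refine Nat.le_floor ?_
      rw [le_div_iff₀ (by positivity)]
      have : (0 : ℝ) ≤ b := Nat.cast_nonneg b
      linarith
    have hNpos : (1 : ℝ) ≤ N := by exact_mod_cast (by omega : 1 ≤ N)
    have hN3 : X / (4 * h) ≤ N := by
      have h1 : X / (2 * h) < N + 1 := Nat.lt_floor_add_one _
      have h3 : X / (2 * h) = X / (4 * h) + X / (4 * h) := by field_simp; norm_num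
      linarith
    have hNX : (N : ℝ) ≤ X := hN1.trans (div_le_self (by linarith) (by linarith))
    have hlt : (h : ℝ) * N + b < X := by
      have h1 : (h : ℝ) * N ≤ X / 2 := by
        calc (h : ℝ) * N ≤ h * (X / (2 * h)) := by gcongr
          _ = X / 2 := by field_simp
      have h3 : (0 : ℝ) ≤ 2 * h * N₁ := by positivity
      linarith
    have hlogN : 0 < Real.log N := Real.log_pos (by exact_mod_cast (by omega : 1 < N))
    have hcardX : ((splitNumbers Q N).card : ℝ) ≤ k * kappa (apollonianPacking D) X := by
      exact_mod_cast hcard N X hlt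
    have h1 : c * (X / (4 * h) / Real.sqrt (Real.log X)) ≤
        k * kappa (apollonianPacking D) X := by
      refine le_trans ?_ ((hsplit N hN2).trans hcardX)
      have hsN : 0 < Real.sqrt (Real.log N) := Real.sqrt_pos.2 hlogN
      gcongr
    calc _ ≤ c / (4 * h * k) * (X / Real.sqrt (Real.log X)) := by
          gcongr
          exact min_le_right _ _
      _ = (c * (X / (4 * h) / Real.sqrt (Real.log X))) / k := by
          field_simp
      _ ≤ _ := by
          rw [div_le_iff₀ hk']
          linarith
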